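/- Fix a pathloss exponent $\alpha>2$, a base-station (BS) height $h>0$ and a threshold $\theta>0$. Let ${}_2F_1$ denote the Gauss hypergeometric function (continued analytically to $(-\infty,1)$), and put $$\eta(s,m,r)={}_2F_1\big(m,-\tfrac2\alpha;1-\tfrac2\alpha;-\tfrac{s}{m r^{\alpha}}\big),\qquad \zeta(m)=-\frac{\Gamma(m+\frac2\alpha)\,\Gamma(-\frac2\alpha)}{\alpha\,\Gamma(m)} .$$ The non-elevated ($h=0$) Rayleigh coverage probabilities for closest (C) and strongest (S) association are $$\mathrm P^{\mathrm{NLOS},(\mathrm C)}(\theta)=\frac1{\eta(\theta,1,1)},\qquad \mathrm P^{\mathrm{NLOS},(\mathrm S)}(\theta)=\frac1{2\zeta(1)\theta^{2/\alpha}} .$$ For BS density $\lambda>0$ the coverage expressions with BSs at height $h$ are $$\mathrm P^{(\mathrm C)}(\theta,\lambda)=\mathrm P^{\mathrm{NLOS},(\mathrm C)}(\theta)\,e^{-\pi\lambda h^2(\eta(\theta,1,1)-1)},\qquad \mathrm P^{(\mathrm S)}(\theta,\lambda)=2\pi\lambda\int_h^\infty e^{-\pi\lambda h^2(\eta(\theta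 r^\alpha,1,h)-1)}\,r\,dr .$$ (1) The integral defining $\mathrm P^{(\mathrm S)}(\theta,\lambda)$ converges for every $\lambda>0$, and (a) $\lim_{\lambda\to0^+}\mathrm P^{(\mathrm C)}(\theta,\lambda)=\mathrm P^{\mathrm{NLOS},(\mathrm C)}(\theta)$; (b) $\lim_{\lambda\to0^+}\mathrm P^{(\mathrm S)}(\theta,\lambda)=\mathrm P^{\mathrm{NLOS},(\mathrm S)}(\theta)$; (c) $\lim_{\lambda\to\infty}\mathrm P^{(\mathrm C)}(\theta,\lambda)=\lim_{\lambda\to\infty}\mathrm P^{(\mathrm S)}(\theta,\lambda)=0$. (2) The same limits hold for the probabilities of coverage themselves. For each $\lambda>0$ let the BSs form a homogeneous Poisson point process $\{x_i\}$ of density $\lambda$ on $\mathbb R^2$, independently marked by i.i.d. $\exp(1)$ fading gains $g_i$, let $\ell(r,h)=(r^2+h^2)^{-\alpha/2}$ and $$\mathrm{SIR}_i=\frac{g_i\,\ell(\|x_i\|,h)}{\sum_{j\ne i}g_j\,\ell(\|x_j\|,h)} .$$ Let $p_{\mathrm C}(\theta,\lambda)$ be the probability that $\mathrm{SIR}_i>\theta$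 for the BS $x_i$ closest to the origin, and $p_{\mathrm S}(\theta,\lambda)$ the probability that $\mathrm{SIR}_i>\theta$ for the BS with the highest SIR. Then $p_{\mathrm C}(\theta,\lambda)\to\mathrm P^{\mathrm{NLOS},(\mathrm C)}(\theta)$ as $\lambda\to0^+$; if $\theta\ge1$, also $p_{\mathrm S}(\theta,\lambda)\to\mathrm P^{\mathrm{NLOS},(\mathrm S)}(\theta)$ as $\lambda\to0^+$; and $p_{\mathrm C}(\theta,\lambda)\to0$ and $p_{\mathrm S}(\theta,\lambda)\to0$ as $\lambda\to\infty$. -/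

import Mathlib

open MeasureTheory ProbabilityTheory Set Filter Topology
open scoped NNReal ENNReal

/-! ### Special functions -/

open Classical in
/-- The Gauss hypergeometric function with real parameters on the half-line `x < 1`: the
real-analytic continuation to `(-∞, 1)` of the Gauss series `₂F₁ a b c`, which converges on
`(-1, 1)`. (Value `0` if there were no such continuation.) -/
noncomputable def gauss2F1 (a b c x : ℝ) : ℝ :=
  if H : ∃ F : ℝ → ℝ, AnalyticOnNhd ℝ F (Iio 1) ∧ ∀ y : ℝ, |y| < 1 → F y = ₂F₁ a b c y then
    H.choose x
  else 0

/-- Any real-analytic continuation of the Gauss series to `(-∞, 1)` computes `gauss2F1`. -/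
theorem gauss2F1_eq {a b c : ℝ} {F : ℝ → ℝ} (hF : AnalyticOnNhd ℝ F (Iio 1))
    (hs : ∀ y : ℝ, |y| < 1 → F y = ₂F₁ a b c y) {x : ℝ} (hx : x < 1) :
    gauss2F1 a b c x = F x := by
  have H : ∃ F : ℝ → ℝ, AnalyticOnNhd ℝ F (Iio 1) ∧
      ∀ y : ℝ, |y| < 1 → F y = ₂F₁ a b c y := ⟨F, hF, hs⟩
  rw [gauss2F1, dif_pos H]
  refine H.choose_spec.1.eqOn_of_preconnected_of_eventuallyEq hF isPreconnected_Iio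
    (z₀ := 0) (by simp) ?_ hx
  filter_upwards [Metric.ball_mem_nhds (0 : ℝ) one_pos] with y hy
  have hy' : |y| < 1 := by simpa using hy
  rw [H.choose_spec.2 y hy', hs y hy']

/-- `η(s, m, r) = ₂F₁(m, -2/α; 1 - 2/α; -s / (m r ^ α))`. -/
noncomputable def eta (α s m r : ℝ) : ℝ :=
  gauss2F1 m (-(2 / α)) (1 - 2 / α) (-(s / (m * r ^ α)))

/-- `ζ(m) = - Γ(m + 2/α) Γ(-2/α) / (α Γ(m))`. -/
noncomputable def zetaFading (α m : ℝ) : ℝ :=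
  -(Real.Gamma (m + 2 / α) * Real.Gamma (-(2 / α))) / (α * Real.Gamma m)

/-! ### Coverage expressions -/

/-- Coverage probability with non-elevated base stations, Rayleigh fading, closest association:
`1 / η(θ, 1, 1)`. -/
noncomputable def covNlosClosest (α θ : ℝ) : ℝ := 1 / eta α θ 1 1

/-- Coverage probability with non-elevated base stations, Rayleigh fading, strongest association:
`1 / (2 ζ(1) θ ^ (2/α))`. -/
noncomputable def covNlosStrongest (α θ : ℝ) : ℝ := 1 / (2 * zetaFading α 1 * θ ^ (2 / α))

/-- Coverage expression with base stations at height `h` and density `lam`, closest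
association. -/
noncomputable def covFormulaClosest (α h θ lam : ℝ) : ℝ :=
  covNlosClosest α θ * Real.exp (-(Real.pi * lam * h ^ 2 * (eta α θ 1 1 - 1)))

/-- The integrand of the coverage expression for strongest association. -/
noncomputable def covIntegrandStrongest (α h θ lam r : ℝ) : ℝ :=
  Real.exp (-(Real.pi * lam * h ^ 2 * (eta α (θ * r ^ α) 1 h - 1))) * r

/-- Coverage expression with base stations at height `h` and density `lam`, strongest
association. -/
noncomputable def covFormulaStrongest (α h θ lam : ℝ) : ℝ :=
  2 * Real.pi * lam * ∫ r in Ioi h, covIntegrandStrongest α h θ lam r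

/-! ### The network -/

/-- The Euclidean plane. -/
abbrev Plane : Type := EuclideanSpace ℝ (Fin 2)

/-- The number of points of the configuration `(X i ω)` that lie in `B`. -/
noncomputable def pointCount {Ω : Type*} (X : ℕ → Ω → Plane) (B : Set Plane) (ω : Ω) : ℕ∞ :=
  {i | X i ω ∈ B}.encard

/-- The points `X i` (listed in some order) form a homogeneous Poisson point process of density
`lam` on the plane: the numbers of points in bounded Borel sets are Poisson distributed with
parameter `lam` times the area, and are independent for disjoint sets. -/
structure IsPoissonProcess {Ω : Type*} [MeasurableSpace Ω] (P : Measure Ω) (lam : ℝ)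
    (X : ℕ → Ω → Plane) : Prop where
  measurable : ∀ i, Measurable (X i)
  count_law : ∀ B : Set Plane, MeasurableSet B → Bornology.IsBounded B → ∀ n : ℕ,
    P {ω | pointCount X B ω = n} = poissonMeasure (Real.toNNReal (lam * volume.real B)) {n}
  count_indep : ∀ (k : ℕ) (B : Fin k → Set Plane), (∀ j, MeasurableSet (B j)) →
    (∀ j, Bornology.IsBounded (B j)) → Pairwise (fun i j => Disjoint (B i) (B j)) →
    iIndepFun (fun j => pointCount X (B j)) P

/-- A cellular network with Rayleigh fading: the base stations `X i` form a homogeneous Poisson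
point process of density `lam`, independently marked by i.i.d. `exp(1)` power fading gains
`g i`. -/
structure IsRayleighNetwork {Ω : Type*} [MeasurableSpace Ω] (P : Measure Ω) (lam : ℝ)
    (X : ℕ → Ω → Plane) (g : ℕ → Ω → ℝ) : Prop where
  isProbabilityMeasure : IsProbabilityMeasure P
  poisson : IsPoissonProcess P lam X
  fading_measurable : ∀ i, Measurable (g i)
  fading_law : ∀ i, P.map (g i) = expMeasure 1
  fading_indep : iIndepFun g P
  marks_indep : IndepFun (fun ω i => X i ω) (fun ω i => g i ω) P

/-- The power-law pathloss `(r ^ 2 + h ^ 2) ^ (-α/2)` at horizontal distance `r` and elevation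
`h`. -/
noncomputable def pathLoss (α h r : ℝ) : ℝ := (r ^ 2 + h ^ 2) ^ (-(α / 2))

section SIR

variable {Ω : Type*} (α h : ℝ) (X : ℕ → Ω → Plane) (g : ℕ → Ω → ℝ)

/-- Power received at the origin from the `i`-th base station. -/
noncomputable def rxPower (i : ℕ) (ω : Ω) : ℝ≥0∞ :=
  ENNReal.ofReal (g i ω * pathLoss α h ‖X i ω‖)

/-- Aggregate interference when the `i`-th base station is serving. -/
noncomputable def interference (i : ℕ) (ω : Ω) : ℝ≥0∞ :=
  ∑' j : {j : ℕ // j ≠ i}, rxPower α h X g j ω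

/-- Signal-to-interference ratio when the `i`-th base station is serving. -/
noncomputable def sir (i : ℕ) (ω : Ω) : ℝ≥0∞ :=
  rxPower α h X g i ω / interference α h X g i ω

/-- Coverage probability at threshold `θ` when the origin is served by the closest base
station. -/
noncomputable def covProbClosest [MeasurableSpace Ω] (P : Measure Ω) (θ : ℝ) : ℝ :=
  P.real {ω | ∃ i, (∀ j, ‖X i ω‖ ≤ ‖X j ω‖) ∧ ENNReal.ofReal θ < sir α h X g i ω}

/-- Coverage probability at threshold `θ` when the origin is served by the base station with the
highest signal-to-interference ratio. -/
noncomputable def covProbStrongest [MeasurableSpace Ω] (P : Measure Ω) (θ : ℝ) : ℝ :=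
  P.real {ω | ∃ i, (∀ j, sir α h X g j ω ≤ sir α h X g i ω) ∧
    ENNReal.ofReal θ < sir α h X g i ω}

end SIR

/-! ### The hypergeometric function as an integral -/

/-! Everything is reduced to one function. With `a = α / 2`, the Gauss function occurring in `η` is
`1 - x ∫_1^∞ dv / (v ^ a - x)` (`gauss2F1_one_neg`), so `η(θ, 1, 1) = 1 + T 1`, where `T y = ∫_y^∞ θ
/ (v ^ a + θ) dv` is `profileTail`.

On the probabilistic side, fix the locations. An exponential gain turns `SIR_i > θ` into the Laplace
transform of the interference, and independence of the gains turns that into a product over `j ≠ i`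
of a kernel `F s_i s_j`, with `s = π ‖x‖²` (`IsRayleighNetwork.measure_lt_sir`). Summing over `i`
and averaging over the Poisson process, the Mecke formula and the void functional give `lam ∫ exp
(-lam ∫ (1 - F s t) dt) ds` (`lintegral_palmSum`). Only the laws of counts are given, so this is
proved by hand: step kernels on annuli of area `δ` are computed exactly from Poisson generating
functions, a monotone kernel lies between two of them, and `δ → 0`.

Put `c = π h²`. For closest association the kernel is cut off at nearer points and the exponent is
`s + (s + c) T 1`, linear in `s`, so the integral is elementary and equals the closed formula. For
strongest association the exponent is `E s = (s + c) T (c / (s + c))`, which is the integral formula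
after `s = π r² - π h²`. The sum over `i` is then the expected number of stations with SIR above
`θ`: it bounds the coverage probability for every `θ`, and equals it when `θ ≥ 1`, since two
stations cannot both exceed `θ`.

The limits follow from `(s + c) T 0 - c ≤ E s ≤ (s + c) T 0` and `(s + c) T 1 ≤ E s`. The first pair
confines the integral between `exp (-lam c T 0) / T 0` and `exp (lam c)` times that, so it tends to
`1 / T 0` as `lam → 0`; the last bound gives exponential decay as `lam → ∞`. Finally `T 0 = Γ(1 +
2/α) Γ(1 - 2/α) θ ^ (2/α)` (`profileTail_zero_eq`), which is `2 ζ(1) θ ^ (2/α)`. -/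

theorem one_sub_le_rpow_sub {a x v : ℝ} (ha : 0 ≤ a) (hv : 1 ≤ v) : 1 - x ≤ v ^ a - x := by
  have := Real.one_le_rpow hv ha
  linarith

theorem integrableOn_inv_rpow_sub {a x : ℝ} (ha : 1 < a) (hx : x < 1) :
    IntegrableOn (fun v : ℝ => (v ^ a - x)⁻¹) (Ioi 1) := by
  have hm : 0 < min 1 (1 - x) := lt_min one_pos (by linarith)
  have h1 : IntegrableOn (fun v : ℝ => (min 1 (1 - x))⁻¹ * v ^ (-a)) (Ioi 1) :=
    (integrableOn_Ioi_rpow_of_lt (by linarith) one_pos).const_mul _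
  refine h1.mono' ?_ ?_
  · exact (by fun_prop : Measurable fun v : ℝ => (v ^ a - x)⁻¹).aestronglyMeasurable
  · refine (ae_restrict_iff' measurableSet_Ioi).2 (ae_of_all _ fun v hv => ?_)
    have hv1 : (1 : ℝ) < v := hv
    have hpow : 1 ≤ v ^ a := Real.one_le_rpow hv1.le (by linarith)
    -- For `x ≤ 0` the constant `1` works; for `x ≥ 0`, `x ≤ x v ^ a` gives the constant `1 - x`.
    have hle : min 1 (1 - x) * v ^ a ≤ v ^ a - x := by
      rcases le_total x 0 with h | h
      · nlinarith [min_le_left 1 (1 - x)]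
      · nlinarith [min_le_right 1 (1 - x)]
    have hp : 0 < min 1 (1 - x) * v ^ a := by positivity
    rw [Real.norm_of_nonneg (by have := hp.trans_le hle; positivity),
      Real.rpow_neg (by linarith), ← mul_inv]
    exact inv_anti₀ hp hle

/-- Geometric expansion of `1 / (v ^ a - x)` about `x₀`: since `v ^ a ≥ 1`, the ratio is at most `|x
- x₀| / (1 - x₀) < 1` uniformly in `v`, so the series integrates termwise. General `x₀` yields
analyticity; `x₀ = 0` yields the Gauss coefficients. -/
theorem hasSum_integral_inv_rpow_sub {a x₀ x : ℝ} (ha : 1 < a) (hx₀ : x₀ < 1)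
    (hx : |x - x₀| < 1 - x₀) :
    HasSum (fun n : ℕ => (x - x₀) ^ n * ∫ v in Ioi (1 : ℝ), ((v ^ a - x₀) ^ (n + 1))⁻¹)
      (∫ v in Ioi (1 : ℝ), (v ^ a - x)⁻¹) := by
  have hpos : 0 < 1 - x₀ := by linarith
  set q := |x - x₀| / (1 - x₀) with hq
  have hq0 : 0 ≤ q := by positivity
  have hq1 : q < 1 := (div_lt_one hpos).2 hx
  have hint := integrableOn_inv_rpow_sub ha hx₀
  have hbound : ∀ n : ℕ, ∀ v ∈ Ioi (1 : ℝ),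
      ‖(x - x₀) ^ n * ((v ^ a - x₀) ^ (n + 1))⁻¹‖ ≤ q ^ n * (v ^ a - x₀)⁻¹ := by
    intro n v hv
    have h1 : 1 - x₀ ≤ v ^ a - x₀ := one_sub_le_rpow_sub (by linarith) (le_of_lt hv)
    have h2 : 0 < v ^ a - x₀ := by linarith
    rw [norm_mul, norm_pow, norm_inv, norm_pow, Real.norm_eq_abs, Real.norm_of_nonneg h2.le,
      pow_succ, mul_inv, ← mul_assoc, ← inv_pow, ← mul_pow, ← div_eq_mul_inv]
    have h3 : |x - x₀| / (v ^ a - x₀) ≤ q := div_le_div_of_nonneg_left (abs_nonneg _) hpos h1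
    have h4 : 0 ≤ |x - x₀| / (v ^ a - x₀) := by positivity
    rw [div_eq_mul_inv (_ ^ n)]
    exact mul_le_mul_of_nonneg_right (pow_le_pow_left₀ h4 h3 n) (inv_nonneg.2 h2.le)
  have hF : ∀ n : ℕ, IntegrableOn
      (fun v : ℝ => (x - x₀) ^ n * ((v ^ a - x₀) ^ (n + 1))⁻¹) (Ioi 1) := by
    intro n
    refine (hint.const_mul (q ^ n)).mono' ?_ ?_
    · exact (by fun_prop : Measurable fun v : ℝ =>
        (x - x₀) ^ n * ((v ^ a - x₀) ^ (n + 1))⁻¹).aestronglyMeasurable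
    · exact (ae_restrict_iff' measurableSet_Ioi).2 (ae_of_all _ (hbound n))
  have hsum : Summable fun n : ℕ =>
      ∫ v in Ioi (1 : ℝ), ‖(x - x₀) ^ n * ((v ^ a - x₀) ^ (n + 1))⁻¹‖ := by
    refine Summable.of_nonneg_of_le (fun n => integral_nonneg fun v => norm_nonneg _)
      (fun n => ?_) ((summable_geometric_of_lt_one hq0 hq1).mul_right
        (∫ v in Ioi (1 : ℝ), (v ^ a - x₀)⁻¹))
    rw [← integral_const_mul]
    exact setIntegral_mono_on (hF n).norm (hint.const_mul _) measurableSet_Ioi (hbound n)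
  have key := hasSum_integral_of_summable_integral_norm hF hsum
  simp only [integral_const_mul] at key
  have hval : ∫ v in Ioi (1 : ℝ), ∑' n : ℕ, (x - x₀) ^ n * ((v ^ a - x₀) ^ (n + 1))⁻¹ =
      ∫ v in Ioi (1 : ℝ), (v ^ a - x)⁻¹ := by
    refine setIntegral_congr_fun measurableSet_Ioi fun v hv => ?_
    have h1 : 1 - x₀ ≤ v ^ a - x₀ := one_sub_le_rpow_sub (by linarith) (le_of_lt hv)
    have h2 : 0 < v ^ a - x₀ := by linarith
    have hlt : |(x - x₀) / (v ^ a - x₀)| < 1 := by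
      rw [abs_div, abs_of_pos h2, div_lt_one h2]
      linarith
    have hg := (hasSum_geometric_of_abs_lt_one hlt).mul_right (v ^ a - x₀)⁻¹
    have hne : v ^ a - x ≠ 0 := by
      have := (abs_lt.1 hx).2
      linarith
    have : (1 - (x - x₀) / (v ^ a - x₀))⁻¹ * (v ^ a - x₀)⁻¹ = (v ^ a - x)⁻¹ := by
      rw [← mul_inv]
      congr 1
      field_simp
      ring
    rw [this] at hg
    rw [← hg.tsum_eq]
    refine tsum_congr fun n => ?_
    rw [div_pow, pow_succ, mul_inv, div_eq_mul_inv]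
    ring
  rwa [hval] at key

theorem analyticOnNhd_integral_inv_rpow_sub {a : ℝ} (ha : 1 < a) :
    AnalyticOnNhd ℝ (fun x => ∫ v in Ioi (1 : ℝ), (v ^ a - x)⁻¹) (Iio 1) := by
  intro x₀ hx₀
  have hx₀' : x₀ < 1 := hx₀
  refine ⟨FormalMultilinearSeries.ofScalars ℝ
    (fun n => ∫ v in Ioi (1 : ℝ), ((v ^ a - x₀) ^ (n + 1))⁻¹), ?_⟩
  rw [hasFPowerSeriesAt_iff]
  filter_upwards [Metric.ball_mem_nhds (0 : ℝ) (sub_pos.2 hx₀')] with z hz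
  have hz' : |x₀ + z - x₀| < 1 - x₀ := by simpa using hz
  have := hasSum_integral_inv_rpow_sub ha hx₀' hz'
  simpa [FormalMultilinearSeries.coeff_ofScalars] using this

/-- Both sides are the Pochhammer symbol of order `n + 1` at `x`. At `x = -b` this collapses the
quotient of Pochhammer symbols of `-b` and `1 - b` in the Gauss series. -/
theorem ascPochhammer_eval_mul_add (x : ℝ) (n : ℕ) :
    (ascPochhammer ℝ n).eval x * (x + n) = x * (ascPochhammer ℝ n).eval (x + 1) := by
  rw [← ascPochhammer_succ_eval, ascPochhammer_succ_left]
  simp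

theorem ordinaryHypergeometric_one_neg {b y : ℝ} (hb0 : b ≠ 0) (hb : b < 1) :
    ₂F₁ (1 : ℝ) (-b) (1 - b) y = ∑' n : ℕ, (-b / (n - b)) * y ^ n := by
  rw [ordinaryHypergeometric_eq_tsum]
  refine tsum_congr fun n => ?_
  rw [smul_eq_mul]
  congr 1
  rcases Nat.eq_zero_or_pos n with rfl | hn
  · simp [hb0]
  have h1 : (ascPochhammer ℝ n).eval 1 = n.factorial := by
    simp [ascPochhammer_eval_one]
  have h2 := ascPochhammer_eval_mul_add (-b) n
  have hn1 : (1 : ℝ) ≤ n := by exact_mod_cast hn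
  have h3 : (-b + n) ≠ 0 := by linarith
  have h4 : (ascPochhammer ℝ n).eval (1 - b) ≠ 0 := (ascPochhammer_pos n _ (by linarith)).ne'
  have h5 : ((n.factorial : ℕ) : ℝ) ≠ 0 := by positivity
  have h6 : (n : ℝ) - b ≠ 0 := by linarith
  rw [h1, inv_mul_cancel₀ h5, one_mul, ← div_eq_mul_inv, div_eq_div_iff h4 h6]
  have : -b + 1 = 1 - b := by ring
  rw [this] at h2
  rw [← h2]
  ring

theorem integral_inv_rpow_pow {a : ℝ} (ha : 1 < a) (n : ℕ) :
    ∫ v in Ioi (1 : ℝ), ((v ^ a) ^ (n + 1))⁻¹ = 1 / (a * (n + 1) - 1) := by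
  have h : (-(a * (n + 1)) : ℝ) < -1 := by nlinarith [(Nat.cast_nonneg n : (0 : ℝ) ≤ n)]
  have h1 : ∫ v in Ioi (1 : ℝ), ((v ^ a) ^ (n + 1))⁻¹ =
      ∫ v in Ioi (1 : ℝ), v ^ (-(a * (n + 1)) : ℝ) := by
    refine setIntegral_congr_fun measurableSet_Ioi fun v hv => ?_
    have hv0 : (0 : ℝ) ≤ v := by linarith [mem_Ioi.1 hv]
    rw [Real.rpow_neg hv0, Real.rpow_mul hv0, ← Real.rpow_natCast]
    push_cast
    rfl
  rw [h1, integral_Ioi_rpow_of_lt h one_pos, Real.one_rpow, ← neg_div_neg_eq]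
  congr 1
  · ring
  · ring

theorem gauss2F1_one_neg {a x : ℝ} (ha : 1 < a) (hx : x < 1) :
    gauss2F1 1 (-(1 / a)) (1 - 1 / a) x = 1 - x * ∫ v in Ioi (1 : ℝ), (v ^ a - x)⁻¹ := by
  have ha0 : 0 < a := by linarith
  have hb1 : 1 / a < 1 := (div_lt_one ha0).2 ha
  refine gauss2F1_eq (F := fun x => 1 - x * ∫ v in Ioi (1 : ℝ), (v ^ a - x)⁻¹) ?_ ?_ hx
  · exact analyticOnNhd_const.sub (analyticOnNhd_id.mul (analyticOnNhd_integral_inv_rpow_sub ha))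
  · intro y hy
    rw [ordinaryHypergeometric_one_neg (by positivity) hb1]
    have h := hasSum_integral_inv_rpow_sub ha (x₀ := 0) one_pos (x := y) (by simpa using hy)
    simp only [sub_zero, integral_inv_rpow_pow ha] at h
    have h2 := (h.mul_left y).neg
    have h3 : HasSum (fun n : ℕ => (-(1 / a) / (n - 1 / a)) * y ^ n)
        (-(y * ∫ v in Ioi (1 : ℝ), (v ^ a - y)⁻¹) + 1) := by
      -- The factor `x` in front of the integral shifts the index by one: the integral supplies the
      -- Gauss coefficients from index 1 on, and the constant `1` is the term of index 0.
      have h4 : ∑ i ∈ Finset.range 1, (-(1 / a) / ((i : ℝ) - 1 / a)) * y ^ i = 1 := by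
        simp [ha0.ne']
      have h5 := hasSum_nat_add_iff (f := fun n : ℕ => (-(1 / a) / (n - 1 / a)) * y ^ n)
        (g := -(y * ∫ v in Ioi (1 : ℝ), (v ^ a - y)⁻¹)) 1
      rw [h4] at h5
      rw [← h5]
      convert h2 using 1
      funext n
      have : a * ((n : ℝ) + 1) - 1 ≠ 0 := by nlinarith [(Nat.cast_nonneg n : (0 : ℝ) ≤ n)]
      push_cast
      rw [show -(1 / a) / ((n : ℝ) + 1 - 1 / a) = -(1 / (a * (n + 1) - 1)) by
        rw [show ((n : ℝ) + 1 - 1 / a) = (a * (n + 1) - 1) / a by field_simp]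
        field_simp]
      ring
    rw [h3.tsum_eq]
    ring

theorem eta_one_eq {α s r : ℝ} (hα : 2 < α) (hs : 0 ≤ s / r ^ α) :
    eta α s 1 r = 1 + ∫ v in Ioi (1 : ℝ), (s / r ^ α) * (v ^ (α / 2) + s / r ^ α)⁻¹ := by
  have h : (2 : ℝ) / α = 1 / (α / 2) := by rw [one_div_div]
  rw [eta, one_mul, h, gauss2F1_one_neg (by linarith) (by linarith), integral_const_mul]
  simp only [sub_neg_eq_add]
  ring

/-! ### Generating functions of Poisson counts -/

theorem tsum_poissonMeasure_mul_pow (r : ℝ≥0) {x : ℝ} (hx : 0 ≤ x) :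
    ∑' n : ℕ, ENNReal.ofReal x ^ n * poissonMeasure r {n} =
      ENNReal.ofReal (Real.exp (-(r * (1 - x)))) := by
  have h := (NormedSpace.expSeries_div_hasSum_exp ((r : ℝ) * x)).mul_left (Real.exp (-r))
  rw [← Real.exp_eq_exp_ℝ, ← Real.exp_add] at h
  rw [show -((r : ℝ) * (1 - x)) = -r + r * x by ring, ← h.tsum_eq,
    ENNReal.ofReal_tsum_of_nonneg (fun n => by positivity) h.summable]
  refine tsum_congr fun n => ?_
  rw [poissonMeasure_singleton, ← ENNReal.ofReal_pow hx, ← ENNReal.ofReal_mul (by positivity)]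
  congr 1
  rw [mul_pow]
  ring

/-- The derivative of the generating function, and the Mecke formula for a single cell: choosing one
of `n` points and weighting the other `n - 1` costs only a factor `r`. -/
theorem tsum_poissonMeasure_mul_deriv_pow (r : ℝ≥0) {x : ℝ} (hx : 0 ≤ x) :
    ∑' n : ℕ, (n * ENNReal.ofReal x ^ (n - 1)) * poissonMeasure r {n} =
      r * ENNReal.ofReal (Real.exp (-(r * (1 - x)))) := by
  rw [tsum_eq_zero_add' ENNReal.summable, ← tsum_poissonMeasure_mul_pow r hx,
    ← ENNReal.tsum_mul_left]
  simp only [Nat.cast_zero, zero_mul, zero_add, Nat.add_sub_cancel]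
  refine tsum_congr fun n => ?_
  rw [poissonMeasure_singleton, poissonMeasure_singleton, ← ENNReal.ofReal_pow hx,
    ← ENNReal.ofReal_natCast, ← ENNReal.ofReal_coe_nnreal, ← ENNReal.ofReal_mul (by positivity),
    ← ENNReal.ofReal_mul (by positivity), ← ENNReal.ofReal_mul (by positivity),
    ← ENNReal.ofReal_mul (by positivity)]
  congr 1
  rw [Nat.factorial_succ]
  push_cast
  field_simp
  ring

section Counts

variable {Ω : Type*} [MeasurableSpace Ω] {P : Measure Ω}

/-- The prescribed masses at finite `n` already add up to 1. -/
theorem measure_count_eq_top [IsProbabilityMeasure P] {N : Ω → ℕ∞} (hN : Measurable N) {r : ℝ≥0}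
    (hlaw : ∀ n : ℕ, P {ω | N ω = n} = poissonMeasure r {n}) : P {ω | N ω = ⊤} = 0 := by
  have h1 : P (⋃ n : ℕ, {ω | N ω = n}) = 1 := by
    rw [measure_iUnion]
    · simp only [hlaw]
      rw [← measure_iUnion (fun m n hmn => by simpa using hmn) (fun n => measurableSet_singleton n)]
      rw [iUnion_of_singleton]
      exact measure_univ
    · intro m n hmn
      refine Set.disjoint_left.2 fun ω hm hn => hmn ?_
      have : (m : ℕ∞) = n := by rw [← mem_ofPred.1 hm, ← mem_ofPred.1 hn]
      exact_mod_cast this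
    · exact fun n => hN (measurableSet_singleton _)
  have h2 : {ω | N ω = ⊤} = (⋃ n : ℕ, {ω | N ω = n})ᶜ := by
    ext ω
    simp only [mem_ofPred_eq, mem_compl_iff, mem_iUnion, not_exists]
    constructor
    · intro h n
      simp [h]
    · intro h
      by_contra h'
      obtain ⟨n, hn⟩ := ENat.ne_top_iff_exists.1 h'
      exact h n hn.symm
  have h3 : MeasurableSet (⋃ n : ℕ, {ω | N ω = n}) :=
    MeasurableSet.iUnion fun n => hN (measurableSet_singleton _)
  rw [h2, prob_compl_eq_zero_iff h3, h1]

theorem lintegral_count_comp [IsProbabilityMeasure P] {N : Ω → ℕ∞} (hN : Measurable N) {r : ℝ≥0}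
    (hlaw : ∀ n : ℕ, P {ω | N ω = n} = poissonMeasure r {n}) (φ : ℕ∞ → ℝ≥0∞) :
    ∫⁻ ω, φ (N ω) ∂P = ∑' n : ℕ, φ n * poissonMeasure r {n} := by
  rw [← lintegral_map (measurable_of_countable φ) hN, lintegral_countable',
    ← Function.Injective.tsum_eq (g := ((↑) : ℕ → ℕ∞)) Nat.cast_injective]
  · refine tsum_congr fun n => ?_
    rw [← hlaw, Measure.map_apply hN (measurableSet_singleton _)]
    rfl
  · intro x hx
    by_contra hx'
    have hxt : x = ⊤ := by
      by_contra h
      obtain ⟨n, hn⟩ := ENat.ne_top_iff_exists.1 h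
      exact hx' ⟨n, hn⟩
    apply hx
    simp only [hxt]
    rw [Measure.map_apply hN (measurableSet_singleton _)]
    have := measure_count_eq_top hN hlaw
    rw [show N ⁻¹' {⊤} = {ω | N ω = ⊤} from rfl, this, mul_zero]

theorem measurable_encard_setOf {E : Type*} {c : ℕ → Ω → E} [MeasurableSpace E] {B : Set E}
    (hB : MeasurableSet B)
    (hc : ∀ i, Measurable (c i)) : Measurable fun ω => {i | c i ω ∈ B}.encard := by
  have hge : ∀ n : ℕ, MeasurableSet {ω | (n : ℕ∞) ≤ {i | c i ω ∈ B}.encard} := by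
    intro n
    have : {ω | (n : ℕ∞) ≤ {i | c i ω ∈ B}.encard} =
        ⋃ (s : Finset ℕ) (_ : s.card = n), ⋂ i ∈ s, c i ⁻¹' B := by
      ext ω
      simp only [mem_ofPred_eq, mem_iUnion, mem_iInter, mem_preimage, exists_prop]
      constructor
      · intro h
        obtain ⟨t, ht, htn⟩ := Set.exists_subset_encard_eq h
        have hfin : t.Finite := Set.finite_of_encard_eq_coe htn
        refine ⟨hfin.toFinset, ?_, fun i hi => ht (hfin.mem_toFinset.1 hi)⟩
        rw [hfin.encard_eq_coe_toFinset_card] at htn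
        exact_mod_cast htn
      · rintro ⟨s, hs, h⟩
        rw [← hs, ← Set.encard_coe_eq_coe_finsetCard]
        exact Set.encard_le_encard fun i hi => h i hi
    rw [this]
    exact MeasurableSet.iUnion fun s => MeasurableSet.iUnion fun _ =>
      Finset.measurableSet_biInter _ fun i _ => hc i hB
  refine measurable_to_countable' fun x => ?_
  have hx : (fun ω => {i | c i ω ∈ B}.encard) ⁻¹' {x} =
      (⋂ (n : ℕ) (_ : (n : ℕ∞) ≤ x), {ω | (n : ℕ∞) ≤ {i | c i ω ∈ B}.encard}) ∩
      (⋂ (n : ℕ) (_ : ¬ (n : ℕ∞) ≤ x), {ω | (n : ℕ∞) ≤ {i | c i ω ∈ B}.encard}ᶜ) := by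
    ext ω
    simp only [mem_preimage, mem_singleton_iff, mem_inter_iff, mem_iInter, mem_ofPred_eq,
      mem_compl_iff]
    constructor
    · rintro rfl
      exact ⟨fun _ h => h, fun _ h => h⟩
    · rintro ⟨h1, h2⟩
      refine le_antisymm (ENat.forall_natCast_le_iff_le.1 fun n hn => ?_)
        (ENat.forall_natCast_le_iff_le.1 h1)
      by_contra h
      exact h2 n h hn
  rw [hx]
  exact (MeasurableSet.iInter fun n => MeasurableSet.iInter fun _ => hge n).inter
    (MeasurableSet.iInter fun n => MeasurableSet.iInter fun _ => (hge n).compl)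

end Counts

/-! ### Sums over the points of a cell -/

/-- Infinite products of factors in `[0, 1]` are encoded as infima over finite subproducts. If all
factors outside `S` are 1, the infimum is attained at `S`. -/
theorem iInf_prod_erase_eq {u : ℕ → ℝ≥0∞} (S : Finset ℕ) (i : ℕ) (hu : ∀ j, u j ≤ 1)
    (hS : ∀ j, j ∉ S → u j = 1) :
    ⨅ s : Finset ℕ, ∏ j ∈ s.erase i, u j = ∏ j ∈ S.erase i, u j := by
  refine le_antisymm (iInf_le _ S) (le_iInf fun s => ?_)
  calc ∏ j ∈ S.erase i, u j ≤ ∏ j ∈ (s.erase i) ∩ (S.erase i), u j :=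
        Finset.prod_le_prod_of_subset_of_le_one' Finset.inter_subset_right fun j _ _ => hu j
    _ = ∏ j ∈ s.erase i, u j := by
        refine Finset.prod_subset Finset.inter_subset_left fun j hj hj' => hS j fun h => hj' ?_
        exact Finset.mem_inter.2 ⟨hj, Finset.mem_erase.2 ⟨(Finset.mem_erase.1 hj).1, h⟩⟩

/-- All points of cell `k` contribute the same product, in which their own factor is omitted once.
The sum is therefore a function of the cell counts alone, to which independence of the counts
applies. -/
theorem tsum_cell_iInf_prod {c : ℕ → ℕ} {w : ℕ → ℝ≥0∞} {k L : ℕ} (hk : k < L)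
    (hw : ∀ l, w l ≤ 1) (hwL : ∀ l, L ≤ l → w l = 1) (hfin : ∀ l < L, {i | c i = l}.Finite) :
    ∑' i, (if c i = k then ⨅ s : Finset ℕ, ∏ j ∈ s.erase i, w (c j) else 0) =
      ∏ l ∈ Finset.range L, (fun N : ℕ∞ => if l = k then N.toNat * w l ^ (N.toNat - 1)
        else w l ^ N.toNat) {i | c i = l}.encard := by
  have hSfin : {j | c j < L}.Finite := by
    have : {j | c j < L} = ⋃ l ∈ Finset.range L, {i | c i = l} := by
      ext j
      simp
    rw [this]
    exact Set.Finite.biUnion (Finset.finite_toSet _) fun l hl => hfin l (by simpa using hl)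
  set S := hSfin.toFinset with hSdef
  have hmem : ∀ j, j ∈ S ↔ c j < L := fun j => by simp [hSdef]
  have hcard : ∀ l < L, {i | c i = l}.encard.toNat = (S.filter fun j => c j = l).card := by
    intro l hl
    have : {i | c i = l} = (S.filter fun j => c j = l : Finset ℕ) := by
      ext j
      simp only [mem_ofPred_eq, Finset.coe_filter, hmem]
      exact ⟨fun h => ⟨h ▸ hl, h⟩, fun h => h.2⟩
    rw [this, Set.encard_coe_eq_coe_finsetCard, ENat.toNat_natCast]
  have hterm : ∀ i, c i = k → ⨅ s : Finset ℕ, ∏ j ∈ s.erase i, w (c j) =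
      w k ^ ((S.filter fun j => c j = k).card - 1) *
        ∏ l ∈ (Finset.range L).erase k, w l ^ (S.filter fun j => c j = l).card := by
    intro i hi
    rw [iInf_prod_erase_eq S i (fun j => hw _)
      (fun j hj => hwL _ (not_lt.1 fun h => hj ((hmem j).2 h)))]
    rw [← Finset.prod_fiberwise_of_maps_to' (t := Finset.range L) (g := c) (f := w)
      (fun j hj => by simpa using (hmem j).1 (Finset.mem_of_mem_erase hj))]
    rw [← Finset.mul_prod_erase _ _ (Finset.mem_range.2 hk)]
    simp only [Finset.prod_const]
    congr 1
    · congr 1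
      rw [Finset.filter_erase, Finset.card_erase_of_mem]
      simp [hmem, hi, hk]
    · refine Finset.prod_congr rfl fun l hl => ?_
      congr 1
      rw [Finset.filter_erase, Finset.erase_eq_of_notMem]
      simp only [Finset.mem_filter, not_and]
      intro _ h
      exact (Finset.mem_erase.1 hl).1 (h ▸ hi)
  rw [tsum_eq_sum (s := S.filter fun j => c j = k)]
  · rw [Finset.sum_congr rfl (g := fun _ => w k ^ ((S.filter fun j => c j = k).card - 1) *
        ∏ l ∈ (Finset.range L).erase k, w l ^ (S.filter fun j => c j = l).card)]
    · rw [Finset.sum_const, nsmul_eq_mul, ← Finset.mul_prod_erase _ _ (Finset.mem_range.2 hk)]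
      simp only [if_true]
      rw [hcard k hk, mul_assoc]
      congr 2
      refine Finset.prod_congr rfl fun l hl => ?_
      rw [if_neg (Finset.mem_erase.1 hl).1, hcard l (by simpa using (Finset.mem_erase.1 hl).2)]
    · intro i hi
      have hi' := (Finset.mem_filter.1 hi).2
      rw [if_pos hi', hterm i hi']
  · intro i hi
    rw [if_neg]
    intro h
    exact hi (Finset.mem_filter.2 ⟨(hmem i).2 (h ▸ hk), h⟩)

section StepMecke

variable {Ω : Type*} [MeasurableSpace Ω] {P : Measure Ω}

/-- The cells `c i` of the points have independent Poisson counts with common parameter `r`. -/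
structure IsPoissonCells (P : Measure Ω) (r : ℝ≥0) (c : ℕ → Ω → ℕ) : Prop where
  measurable : ∀ i, Measurable (c i)
  count_law : ∀ l n : ℕ, P {ω | {i | c i ω = l}.encard = n} = poissonMeasure r {n}
  count_indep : ∀ L : ℕ, iIndepFun (fun (l : Fin L) ω => {i | c i ω = l}.encard) P

theorem measurable_iInf_prod_erase {f : ℕ → Ω → ℝ≥0∞} (hf : ∀ j, Measurable (f j)) (i : ℕ) :
    Measurable fun ω => ⨅ s : Finset ℕ, ∏ j ∈ s.erase i, f j ω :=
  Measurable.iInf fun _ => Finset.measurable_fun_prod _ fun j _ => hf j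

theorem IsPoissonCells.measurable_count {r : ℝ≥0} {c : ℕ → Ω → ℕ} (hc : IsPoissonCells P r c)
    (l : ℕ) : Measurable fun ω => {i | c i ω = l}.encard :=
  measurable_encard_setOf (measurableSet_singleton l) hc.measurable

theorem IsPoissonCells.lintegral_cell_of_truncated [IsProbabilityMeasure P] {r : ℝ≥0}
    {c : ℕ → Ω → ℕ} (hc : IsPoissonCells P r c) {x : ℕ → ℝ} {k L : ℕ} (hk : k < L)
    (hx0 : ∀ l, 0 ≤ x l) (hx1 : ∀ l, x l ≤ 1) (hxL : ∀ l, L ≤ l → x l = 1) :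
    ∫⁻ ω, ∑' i, (if c i ω = k then
        ⨅ s : Finset ℕ, ∏ j ∈ s.erase i, ENNReal.ofReal (x (c j ω)) else 0) ∂P =
      r * ENNReal.ofReal (Real.exp (-(r * ∑ l ∈ Finset.range L, (1 - x l)))) := by
  set w : ℕ → ℝ≥0∞ := fun l => ENNReal.ofReal (x l) with hw
  set φ : ℕ → ℕ∞ → ℝ≥0∞ := fun l N =>
    if l = k then N.toNat * w l ^ (N.toNat - 1) else w l ^ N.toNat with hφ
  -- `ENat.toNat` sends `⊤` to 0, so the identity in terms of counts is used only where all counts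
  -- are finite.
  have hfin : ∀ᵐ ω ∂P, ∀ l : ℕ, {i | c i ω = l}.Finite := by
    refine ae_all_iff.2 fun l => ?_
    have h := measure_count_eq_top (hc.measurable_count l) (hc.count_law l)
    refine (measure_eq_zero_iff_ae_notMem.1 h).mono fun ω hω => ?_
    exact Set.encard_ne_top_iff.1 hω
  have h1 : ∫⁻ ω, ∑' i, (if c i ω = k then
        ⨅ s : Finset ℕ, ∏ j ∈ s.erase i, w (c j ω) else 0) ∂P =
      ∫⁻ ω, ∏ l : Fin L, φ l {i | c i ω = l}.encard ∂P := by
    refine lintegral_congr_ae (hfin.mono fun ω hω => ?_)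
    have := tsum_cell_iInf_prod (c := fun i => c i ω) (w := w) hk
      (fun l => ENNReal.ofReal_le_one.2 (hx1 l)) (fun l hl => by simp [hw, hxL l hl])
      (fun l _ => hω l)
    simp only [this]
    rw [Finset.prod_range]
  rw [h1, lintegral_prod_eq_prod_lintegral_of_indepFun _
    (fun (l : Fin L) ω => φ l {i | c i ω = l}.encard)
    ((hc.count_indep L).comp (fun l => φ l) fun l => measurable_of_countable _)
    (fun l => (measurable_of_countable (φ l)).comp (hc.measurable_count l)),
    ← Finset.prod_range (fun l => ∫⁻ ω, φ l {i | c i ω = l}.encard ∂P)]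
  have hval : ∀ l, ∫⁻ ω, φ l {i | c i ω = l}.encard ∂P =
      (if l = k then (r : ℝ≥0∞) else 1) * ENNReal.ofReal (Real.exp (-(r * (1 - x l)))) := by
    intro l
    rw [lintegral_count_comp (hc.measurable_count l) (hc.count_law l)]
    by_cases h : l = k
    · simp only [hφ, h, if_true, ENat.toNat_natCast, hw]
      exact tsum_poissonMeasure_mul_deriv_pow r (hx0 k)
    · simp only [hφ, h, if_false, ENat.toNat_natCast, hw, one_mul]
      exact tsum_poissonMeasure_mul_pow r (hx0 l)
  simp only [hval]
  rw [Finset.prod_mul_distrib, Finset.prod_ite_eq' , if_pos (Finset.mem_range.2 hk),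
    ← ENNReal.ofReal_prod_of_nonneg (fun l _ => (Real.exp_pos _).le), ← Real.exp_sum,
    Finset.mul_sum, Finset.sum_neg_distrib]

theorem tsum_iInf_of_antitone {f : ℕ → ℕ → ℝ≥0∞} (hf : ∀ i, Antitone fun m => f m i)
    (h0 : ∑' i, f 0 i ≠ ∞) : ∑' i, ⨅ m, f m i = ⨅ m, ∑' i, f m i := by
  simp only [← lintegral_count] at h0 ⊢
  exact lintegral_iInf (fun m => measurable_of_countable _)
    (fun m n hmn i => hf i hmn) h0

theorem IsPoissonCells.lintegral_cell [IsProbabilityMeasure P] {r : ℝ≥0}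
    {c : ℕ → Ω → ℕ} (hc : IsPoissonCells P r c) {x : ℕ → ℝ} (k : ℕ)
    (hx0 : ∀ l, 0 ≤ x l) (hx1 : ∀ l, x l ≤ 1) :
    ∫⁻ ω, ∑' i, (if c i ω = k then
        ⨅ s : Finset ℕ, ∏ j ∈ s.erase i, ENNReal.ofReal (x (c j ω)) else 0) ∂P =
      ⨅ m : ℕ, r * ENNReal.ofReal
        (Real.exp (-(r * ∑ l ∈ Finset.range (k + 1 + m), (1 - x l)))) := by
  -- Truncation at level `k + 1 + m` keeps cell `k` below the cutoff for every `m` and decreases to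
  -- `x` as `m` grows.
  set y : ℕ → ℕ → ℝ := fun m l => if l < k + 1 + m then x l else 1 with hy
  have hy0 : ∀ m l, 0 ≤ y m l := fun m l => by
    simp only [hy]; split_ifs; exacts [hx0 l, zero_le_one]
  have hy1 : ∀ m l, y m l ≤ 1 := fun m l => by
    simp only [hy]; split_ifs; exacts [hx1 l, le_rfl]
  have hanti : ∀ l, Antitone fun m => y m l := by
    intro l m n hmn
    simp only [hy]
    by_cases h : l < k + 1 + m
    · rw [if_pos h, if_pos (by omega)]
    · rw [if_neg h]
      exact hy1 n l
  have htr := fun m => hc.lintegral_cell_of_truncated (k := k) (L := k + 1 + m) (x := y m)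
    (by omega) (hy0 m) (hy1 m) (fun l hl => by simp only [hy]; rw [if_neg (by omega)])
  set f : ℕ → ℕ → Ω → ℝ≥0∞ := fun m i ω => if c i ω = k then
        ⨅ s : Finset ℕ, ∏ j ∈ s.erase i, ENNReal.ofReal (y m (c j ω)) else 0 with hf
  have hfm : ∀ m i, Measurable (f m i) := fun m i =>
    Measurable.ite (hc.measurable i (measurableSet_singleton k))
      (measurable_iInf_prod_erase (fun j =>
        (measurable_of_countable fun l => ENNReal.ofReal (y m l)).comp (hc.measurable j)) i)
      measurable_const
  have hfanti : ∀ i ω, Antitone fun m => f m i ω := by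
    intro i ω m n hmn
    simp only [hf]
    split_ifs
    · exact iInf_mono fun s => Finset.prod_le_prod' fun j _ =>
        ENNReal.ofReal_le_ofReal (hanti _ hmn)
    · exact le_rfl
  have hpt : ∀ i ω, (if c i ω = k then
        ⨅ s : Finset ℕ, ∏ j ∈ s.erase i, ENNReal.ofReal (x (c j ω)) else 0) = ⨅ m, f m i ω := by
    intro i ω
    by_cases h : c i ω = k
    · simp only [hf, h, if_true]
      rw [iInf_comm]
      refine iInf_congr fun s => le_antisymm (le_iInf fun m => ?_) ?_
      · refine Finset.prod_le_prod' fun j _ => ENNReal.ofReal_le_ofReal ?_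
        simp only [hy]
        split_ifs
        exacts [le_rfl, hx1 _]
      -- A finite set `s` of points meets only finitely many cells; a cutoff beyond the largest of
      -- them restores all factors.
      · refine (iInf_le _ (s.sup fun j => c j ω)).trans (le_of_eq ?_)
        refine Finset.prod_congr rfl fun j hj => ?_
        simp only [hy]
        rw [if_pos]
        have := Finset.le_sup (f := fun j => c j ω) (Finset.mem_of_mem_erase hj)
        omega
    · simp [hf, h]
  have hfinite : ∫⁻ ω, ∑' i, f 0 i ω ∂P ≠ ∞ := by
    rw [htr 0]
    exact ENNReal.mul_ne_top ENNReal.coe_ne_top ENNReal.ofReal_ne_top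
  simp only [hpt]
  -- The infimum over `m` passes through the sum and then the integral by decreasing monotone
  -- convergence; both need finiteness at `m = 0`.
  have hae : ∀ᵐ ω ∂P, ∑' i, ⨅ m, f m i ω = ⨅ m, ∑' i, f m i ω := by
    refine (ae_lt_top (Measurable.tsum fun i => hfm 0 i) hfinite).mono fun ω hω => ?_
    exact tsum_iInf_of_antitone (fun i => hfanti i ω) hω.ne
  rw [lintegral_congr_ae hae, lintegral_iInf (fun m => Measurable.tsum fun i => hfm m i)
    (fun m n hmn ω => ENNReal.tsum_le_tsum fun i => hfanti i ω hmn) hfinite]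
  refine iInf_congr fun m => ?_
  rw [htr m]
  congr 5
  refine Finset.sum_congr rfl fun l hl => ?_
  simp only [hy]
  rw [if_pos (Finset.mem_range.1 hl)]

end StepMecke

/-! ### Comparison of sums and integrals -/

theorem iUnion_Ioc_natCast_mul {δ : ℝ} (hδ : 0 < δ) :
    ⋃ k : ℕ, Ioc ((k : ℝ) * δ) ((k + 1 : ℝ) * δ) = Ioi 0 := by
  have hu : ¬ BddAbove (range fun k : ℕ => (k : ℝ) * δ) := by
    rintro ⟨M, hM⟩
    obtain ⟨n, hn⟩ := exists_nat_gt (M / δ)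
    rw [div_lt_iff₀ hδ] at hn
    exact absurd (hM ⟨n, rfl⟩) (not_le.2 hn)
  have := iUnion_Ioc_map_succ_eq_Ioi (f := fun k : ℕ => (k : ℝ) * δ)
    (fun k => by simpa using by positivity) hu
  simpa using this

theorem tsum_lintegral_Ioc {δ : ℝ} (hδ : 0 < δ) (e : ℝ → ℝ≥0∞) :
    ∑' k : ℕ, ∫⁻ s in Ioc ((k : ℝ) * δ) ((k + 1 : ℝ) * δ), e s = ∫⁻ s in Ioi 0, e s := by
  rw [← iUnion_Ioc_natCast_mul hδ, lintegral_iUnion (fun k => measurableSet_Ioc)]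
  have hm : Monotone fun k : ℕ => (k : ℝ) * δ := fun m n h => by
    simp only
    gcongr
  have := hm.pairwise_disjoint_on_Ioc_succ
  simpa [Function.onFun] using this

/-- For decreasing `e`, the term at `(k + 1) δ` is at most the integral over the interval to its
left; the term at 0 has no such interval and costs `δ`. -/
theorem tsum_le_add_lintegral {δ : ℝ} (hδ : 0 < δ) {e : ℝ → ℝ≥0∞} (he : AntitoneOn e (Ici 0))
    (he1 : e 0 ≤ 1) :
    ∑' k : ℕ, ENNReal.ofReal δ * e (k * δ) ≤ ENNReal.ofReal δ + ∫⁻ s in Ioi 0, e s := by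
  rw [tsum_eq_zero_add' ENNReal.summable, ← tsum_lintegral_Ioc hδ]
  refine add_le_add ?_ (ENNReal.tsum_le_tsum fun k => ?_)
  · simpa using mul_le_mul_right he1 (ENNReal.ofReal δ)
  · calc ENNReal.ofReal δ * e ((k + 1 : ℕ) * δ)
        = ∫⁻ s in Ioc ((k : ℝ) * δ) ((k + 1 : ℝ) * δ), e ((k + 1 : ℝ) * δ) := by
          rw [setLIntegral_const, Real.volume_Ioc, mul_comm]
          push_cast
          congr 2
          ring
      _ ≤ _ := by
          refine setLIntegral_mono' measurableSet_Ioc fun s hs => ?_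
          have h0 : (0 : ℝ) ≤ k * δ := by positivity
          exact he (mem_Ici.2 (h0.trans hs.1.le)) (mem_Ici.2 (by positivity)) hs.2

theorem lintegral_le_add_tsum {δ : ℝ} (hδ : 0 < δ) {e : ℝ → ℝ≥0∞} (he : AntitoneOn e (Ici 0))
    (he1 : e 0 ≤ 1) :
    ∫⁻ s in Ioi 0, e s ≤
      ENNReal.ofReal δ + ∑' k : ℕ, ENNReal.ofReal δ * e ((k + 1 : ℝ) * δ) := by
  rw [← tsum_lintegral_Ioc hδ]
  have h1 : ∑' k : ℕ, ∫⁻ s in Ioc ((k : ℝ) * δ) ((k + 1 : ℝ) * δ), e s ≤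
      ∑' k : ℕ, ENNReal.ofReal δ * e (k * δ) := by
    refine ENNReal.tsum_le_tsum fun k => ?_
    calc ∫⁻ s in Ioc ((k : ℝ) * δ) ((k + 1 : ℝ) * δ), e s
        ≤ ∫⁻ s in Ioc ((k : ℝ) * δ) ((k + 1 : ℝ) * δ), e (k * δ) := by
          refine setLIntegral_mono' measurableSet_Ioc fun s hs => ?_
          have h0 : (0 : ℝ) ≤ k * δ := by positivity
          exact he (mem_Ici.2 h0) (mem_Ici.2 (h0.trans hs.1.le)) hs.1.le
      _ = _ := by
          rw [setLIntegral_const, Real.volume_Ioc, mul_comm]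
          congr 2
          ring
  refine h1.trans ?_
  rw [tsum_eq_zero_add' ENNReal.summable]
  refine add_le_add ?_ (le_of_eq ?_)
  · simpa using mul_le_mul_right he1 (ENNReal.ofReal δ)
  · simp

theorem intervalIntegral_le_mul_sum {f : ℝ → ℝ} (hf : AntitoneOn f (Ici 0)) {δ : ℝ} (hδ : 0 < δ)
    (n : ℕ) : ∫ t in 0..n * δ, f t ≤ δ * ∑ l ∈ Finset.range n, f (l * δ) := by
  have h := AntitoneOn.integral_le_sum (x₀ := 0) (a := n) (f := fun x => f (x * δ))
    (fun x hx y hy hxy => hf (mem_Ici.2 (mul_nonneg hx.1 hδ.le)) (mem_Ici.2 (mul_nonneg hy.1 hδ.le))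
      (by gcongr))
  rw [intervalIntegral.integral_comp_mul_right _ hδ.ne'] at h
  simp only [zero_mul, zero_add, smul_eq_mul] at h
  rwa [inv_mul_le_iff₀ hδ] at h

theorem mul_sum_le_intervalIntegral {f : ℝ → ℝ} (hf : AntitoneOn f (Ici 0)) {δ : ℝ} (hδ : 0 < δ)
    (n : ℕ) : δ * ∑ l ∈ Finset.range n, f ((l + 1 : ℝ) * δ) ≤ ∫ t in 0..n * δ, f t := by
  have h := AntitoneOn.sum_le_integral (x₀ := 0) (a := n) (f := fun x => f (x * δ))
    (fun x hx y hy hxy => hf (mem_Ici.2 (mul_nonneg hx.1 hδ.le)) (mem_Ici.2 (mul_nonneg hy.1 hδ.le))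
      (by gcongr))
  rw [intervalIntegral.integral_comp_mul_right _ hδ.ne'] at h
  simp only [zero_mul, zero_add, smul_eq_mul, Nat.cast_add, Nat.cast_one] at h
  rwa [le_inv_mul_iff₀ hδ] at h

/-- Left and right Riemann sums differ only by boundary values, hence by at most `δ` after scaling
when `f` takes values in `[0, 1]`. -/
theorem sum_range_shift (f : ℝ → ℝ) (δ : ℝ) (n : ℕ) :
    ∑ l ∈ Finset.range n, f (l * δ) =
      ∑ l ∈ Finset.range n, f ((l + 1 : ℝ) * δ) + f 0 - f (n * δ) := by
  have h1 := Finset.sum_range_succ (fun l : ℕ => f (l * δ)) n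
  have h2 := Finset.sum_range_succ' (fun l : ℕ => f (l * δ)) n
  simp only [Nat.cast_add, Nat.cast_one, Nat.cast_zero, zero_mul] at h1 h2
  linarith

/-! ### Annuli of equal area -/

/-- The index `l` of the annulus `l δ ≤ π ‖x‖² < (l + 1) δ` that contains `x`. -/
noncomputable def annulusIndex (δ : ℝ) (x : Plane) : ℕ := ⌊Real.pi * ‖x‖ ^ 2 / δ⌋₊

theorem measurable_annulusIndex (δ : ℝ) : Measurable (annulusIndex δ) :=
  Nat.measurable_floor.comp (by fun_prop)

theorem annulusIndex_eq_iff {δ : ℝ} (hδ : 0 < δ) (x : Plane) (l : ℕ) :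
    annulusIndex δ x = l ↔ l * δ ≤ Real.pi * ‖x‖ ^ 2 ∧ Real.pi * ‖x‖ ^ 2 < (l + 1) * δ := by
  rw [annulusIndex, Nat.floor_eq_iff (by positivity), le_div_iff₀ hδ, div_lt_iff₀ hδ]

theorem annulus_eq_diff {δ : ℝ} (hδ : 0 < δ) (l : ℕ) :
    {x | annulusIndex δ x = l} = Metric.ball (0 : Plane) (√((l + 1) * δ / Real.pi)) \
      Metric.ball 0 (√(l * δ / Real.pi)) := by
  ext x
  rw [mem_ofPred_eq, annulusIndex_eq_iff hδ, Set.mem_sdiff, mem_ball_zero_iff, mem_ball_zero_iff, not_lt,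
    Real.lt_sqrt (norm_nonneg _), Real.sqrt_le_left (norm_nonneg _), lt_div_iff₀ Real.pi_pos,
    div_le_iff₀ Real.pi_pos, and_comm, mul_comm Real.pi]

/-- The coordinate `π ‖x‖²` carries area to length on the half-line, so equal steps give cells of
equal area and a common Poisson parameter. -/
theorem volume_annulus {δ : ℝ} (hδ : 0 < δ) (l : ℕ) :
    volume.real {x | annulusIndex δ x = l} = δ := by
  have hball : ∀ y : ℝ, 0 ≤ y →
      volume.real (Metric.ball (0 : Plane) (√(y / Real.pi))) = y := by
    intro y hy
    rw [measureReal_def, EuclideanSpace.volume_ball_fin_two, ← ENNReal.ofReal_pow (by positivity),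
      ← ENNReal.ofReal_mul (by positivity), ENNReal.toReal_ofReal (by positivity),
      Real.sq_sqrt (by positivity), div_mul_cancel₀ _ Real.pi_ne_zero]
  rw [annulus_eq_diff hδ, measureReal_sdiff _ measurableSet_ball, hball _ (by positivity),
    hball _ (by positivity)]
  · ring
  · refine Metric.ball_subset_ball (Real.sqrt_le_sqrt ?_)
    gcongr
    linarith

theorem IsPoissonProcess.isPoissonCells {Ω : Type*} [MeasurableSpace Ω] {P : Measure Ω} {lam : ℝ}
    {X : ℕ → Ω → Plane} (hX : IsPoissonProcess P lam X) {δ : ℝ} (hδ : 0 < δ) :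
    IsPoissonCells P (Real.toNNReal (lam * δ)) fun i ω => annulusIndex δ (X i ω) := by
  have hmeas : ∀ l : ℕ, MeasurableSet {x | annulusIndex δ x = l} := fun l =>
    measurable_annulusIndex δ (measurableSet_singleton l)
  have hbdd : ∀ l : ℕ, Bornology.IsBounded {x | annulusIndex δ x = l} := fun l => by
    rw [annulus_eq_diff hδ]
    exact Metric.isBounded_ball.subset sdiff_subset
  refine ⟨fun i => (measurable_annulusIndex δ).comp (hX.measurable i), fun l n => ?_, fun L => ?_⟩
  · have := hX.count_law _ (hmeas l) (hbdd l) n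
    rwa [volume_annulus hδ] at this
  · exact hX.count_indep L (fun l => {x | annulusIndex δ x = l}) (fun l => hmeas l)
      (fun l => hbdd l) fun i j hij => Set.disjoint_left.2 fun x hi hj => hij
        (Fin.ext ((mem_ofPred.1 hi).symm.trans (mem_ofPred.1 hj)))

/-! ### The Mecke formula for monotone radial kernels -/

/-- A kernel on `[0, ∞)²` with values in `[0, 1]`, decreasing in the first variable, increasing
in the second variable, and with `1 - F s` integrable. -/
structure IsMonotoneKernel (F : ℝ → ℝ → ℝ) : Prop where
  nonneg : ∀ s t, 0 ≤ s → 0 ≤ t → 0 ≤ F s t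
  le_one : ∀ s t, 0 ≤ s → 0 ≤ t → F s t ≤ 1
  anti_left : ∀ s s' t, 0 ≤ s → s ≤ s' → 0 ≤ t → F s' t ≤ F s t
  mono_right : ∀ s t t', 0 ≤ s → 0 ≤ t → t ≤ t' → F s t ≤ F s t'
  integrableOn : ∀ s, 0 ≤ s → IntegrableOn (fun t => 1 - F s t) (Ioi 0)

/-- The integral of `1 - F s`. -/
noncomputable def kernelExponent (F : ℝ → ℝ → ℝ) (s : ℝ) : ℝ := ∫ t in Ioi 0, (1 - F s t)

/-- The sum over the points `i` of the products of `F s_i s_j` over `j ≠ i`, where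
`s_i = π ‖x_i‖²`. -/
noncomputable def palmSum (F : ℝ → ℝ → ℝ) (x : ℕ → Plane) : ℝ≥0∞ :=
  ∑' i, ⨅ s : Finset ℕ, ∏ j ∈ s.erase i,
    ENNReal.ofReal (F (Real.pi * ‖x i‖ ^ 2) (Real.pi * ‖x j‖ ^ 2))

namespace IsMonotoneKernel

variable {F : ℝ → ℝ → ℝ}

theorem antitoneOn_one_sub (hF : IsMonotoneKernel F) {s : ℝ} (hs : 0 ≤ s) :
    AntitoneOn (fun t => 1 - F s t) (Ici 0) :=
  fun t ht t' _ htt' => by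
    have := hF.mono_right s t t' hs ht htt'
    simp only
    linarith

theorem kernelExponent_mono (hF : IsMonotoneKernel F) {s s' : ℝ} (hs : 0 ≤ s) (h : s ≤ s') :
    kernelExponent F s ≤ kernelExponent F s' :=
  setIntegral_mono_on (hF.integrableOn s hs) (hF.integrableOn s' (hs.trans h)) measurableSet_Ioi
    fun t ht => by
      have := hF.anti_left s s' t hs h (le_of_lt ht)
      linarith

theorem kernelExponent_nonneg (hF : IsMonotoneKernel F) {s : ℝ} (hs : 0 ≤ s) : 0 ≤ kernelExponent F s :=
  setIntegral_nonneg measurableSet_Ioi fun t ht => by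
    have := hF.le_one s t hs (le_of_lt ht)
    linarith

theorem le_mul_sum_upper (hF : IsMonotoneKernel F) {s δ : ℝ} (hs : 0 ≤ s) (hδ : 0 < δ)
    (n : ℕ) :
    (∫ t in 0..n * δ, (1 - F s t)) - δ ≤
      δ * ∑ l ∈ Finset.range n, (1 - F s ((l + 1 : ℝ) * δ)) := by
  have h1 := intervalIntegral_le_mul_sum (hF.antitoneOn_one_sub hs) hδ n
  have h2 := sum_range_shift (fun t => 1 - F s t) δ n
  have h3 := hF.nonneg s 0 hs le_rfl
  have h4 := hF.le_one s (n * δ) hs (by positivity)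
  rw [h2] at h1
  nlinarith

theorem mul_sum_lower_le (hF : IsMonotoneKernel F) {s δ : ℝ} (hs : 0 ≤ s) (hδ : 0 < δ)
    (n : ℕ) :
    δ * ∑ l ∈ Finset.range n, (1 - F s (l * δ)) ≤ kernelExponent F s + δ := by
  have h1 := mul_sum_le_intervalIntegral (hF.antitoneOn_one_sub hs) hδ n
  have h2 := sum_range_shift (fun t => 1 - F s t) δ n
  have h3 := hF.nonneg s 0 hs le_rfl
  have h4 := hF.le_one s (n * δ) hs (by positivity)
  have h5 : ∫ t in 0..n * δ, (1 - F s t) ≤ kernelExponent F s := by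
    rw [intervalIntegral.integral_of_le (by positivity)]
    refine setIntegral_mono_set (hF.integrableOn s hs) ?_ Ioc_subset_Ioi_self.eventuallyLE
    refine (ae_restrict_iff' measurableSet_Ioi).2 (ae_of_all _ fun t ht => ?_)
    have := hF.le_one s t hs (le_of_lt ht)
    simp only [Pi.zero_apply]
    linarith
  rw [h2]
  nlinarith

theorem antitoneOn_exp (hF : IsMonotoneKernel F) (lam : ℝ) (hlam : 0 ≤ lam) :
    AntitoneOn (fun s => ENNReal.ofReal (Real.exp (-(lam * kernelExponent F s)))) (Ici 0) := by
  intro s hs s' _ h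
  refine ENNReal.ofReal_le_ofReal (Real.exp_le_exp.2 (neg_le_neg ?_))
  exact mul_le_mul_of_nonneg_left (hF.kernelExponent_mono hs h) hlam

theorem exp_zero_le_one (hF : IsMonotoneKernel F) (lam : ℝ) (hlam : 0 ≤ lam) :
    ENNReal.ofReal (Real.exp (-(lam * kernelExponent F 0))) ≤ 1 := by
  rw [ENNReal.ofReal_le_one, Real.exp_le_one_iff]
  have := mul_nonneg hlam (hF.kernelExponent_nonneg le_rfl)
  linarith

end IsMonotoneKernel

theorem tsum_step_eq {c : ℕ → ℕ} (y : ℕ → ℕ → ℝ) :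
    ∑' i, ⨅ s : Finset ℕ, ∏ j ∈ s.erase i, ENNReal.ofReal (y (c i) (c j)) =
      ∑' k, ∑' i, if c i = k then
        ⨅ s : Finset ℕ, ∏ j ∈ s.erase i, ENNReal.ofReal (y k (c j)) else 0 := by
  rw [ENNReal.tsum_comm]
  refine tsum_congr fun i => ?_
  rw [tsum_eq_single (c i) fun k hk => if_neg (Ne.symm hk), if_pos rfl]

theorem IsPoissonCells.lintegral_step {Ω : Type*} [MeasurableSpace Ω] {P : Measure Ω}
    [IsProbabilityMeasure P] {r : ℝ≥0} {c : ℕ → Ω → ℕ} (hc : IsPoissonCells P r c)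
    {y : ℕ → ℕ → ℝ} (hy0 : ∀ k l, 0 ≤ y k l) (hy1 : ∀ k l, y k l ≤ 1) :
    ∫⁻ ω, ∑' i, ⨅ s : Finset ℕ, ∏ j ∈ s.erase i, ENNReal.ofReal (y (c i ω) (c j ω)) ∂P =
      ∑' k, ⨅ m : ℕ, r * ENNReal.ofReal
        (Real.exp (-(r * ∑ l ∈ Finset.range (k + 1 + m), (1 - y k l)))) := by
  simp only [tsum_step_eq (c := fun i => c i _)]
  rw [lintegral_tsum]
  · exact tsum_congr fun k => hc.lintegral_cell k (hy0 k) (hy1 k)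
  · intro k
    refine (Measurable.tsum fun i => ?_).aemeasurable
    exact Measurable.ite (hc.measurable i (measurableSet_singleton k))
      (measurable_iInf_prod_erase (fun j =>
        (measurable_of_countable fun l => ENNReal.ofReal (y k l)).comp (hc.measurable j)) i)
      measurable_const

section Mecke

variable {Ω : Type*} [MeasurableSpace Ω] {P : Measure Ω} [IsProbabilityMeasure P] {lam : ℝ}
  {X : ℕ → Ω → Plane} {F : ℝ → ℝ → ℝ}

/-- Monotonicity makes `F (k δ) ((l + 1) δ)` an upper bound for `F` on cell `k` times cell `l`. The
error in the exponent gives the factor `exp (lam δ)`; the Riemann sum in `s` gives the additive `δ`.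
-/
theorem lintegral_palmSum_le_of_pos (hF : IsMonotoneKernel F) (hX : IsPoissonProcess P lam X)
    (hlam : 0 < lam) {δ : ℝ} (hδ : 0 < δ) :
    ∫⁻ ω, palmSum F (fun i => X i ω) ∂P ≤ ENNReal.ofReal (Real.exp (lam * δ)) *
      (ENNReal.ofReal lam * (ENNReal.ofReal δ +
        ∫⁻ s in Ioi 0, ENNReal.ofReal (Real.exp (-(lam * kernelExponent F s))))) := by
  have hc := hX.isPoissonCells hδ
  set y : ℕ → ℕ → ℝ := fun k l => F (k * δ) ((l + 1 : ℝ) * δ) with hy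
  have hstep := hc.lintegral_step (y := y) (fun k l => hF.nonneg _ _ (by positivity) (by positivity))
    (fun k l => hF.le_one _ _ (by positivity) (by positivity))
  have hle : ∫⁻ ω, palmSum F (fun i => X i ω) ∂P ≤
      ∫⁻ ω, ∑' i, ⨅ s : Finset ℕ, ∏ j ∈ s.erase i,
        ENNReal.ofReal (y (annulusIndex δ (X i ω)) (annulusIndex δ (X j ω))) ∂P := by
    refine lintegral_mono fun ω => ENNReal.tsum_le_tsum fun i => iInf_mono fun s =>
      Finset.prod_le_prod' fun j _ => ENNReal.ofReal_le_ofReal ?_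
    have hi := (annulusIndex_eq_iff hδ (X i ω) _).1 rfl
    have hj := (annulusIndex_eq_iff hδ (X j ω) _).1 rfl
    exact (hF.anti_left _ _ _ (by positivity) hi.1 (by positivity)).trans
      (hF.mono_right _ _ _ (by positivity) (by positivity) hj.2.le)
  refine hle.trans (hstep.trans_le ?_)
  refine le_trans ?_ (mul_le_mul_right (mul_le_mul_right (tsum_le_add_lintegral hδ
    (hF.antitoneOn_exp lam hlam.le) (hF.exp_zero_le_one lam hlam.le)) _) _)
  rw [← ENNReal.tsum_mul_left, ← ENNReal.tsum_mul_left]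
  refine ENNReal.tsum_le_tsum fun k => ?_
  have hlim : Tendsto (fun m : ℕ => (Real.toNNReal (lam * δ) : ℝ≥0∞) * ENNReal.ofReal
      (Real.exp (-(lam * ((∫ t in 0..(k + 1 + m : ℕ) * δ, (1 - F (k * δ) t)) - δ))))) atTop
      (𝓝 ((Real.toNNReal (lam * δ) : ℝ≥0∞) * ENNReal.ofReal
        (Real.exp (-(lam * (kernelExponent F (k * δ) - δ)))))) := by
    refine ENNReal.Tendsto.const_mul (ENNReal.tendsto_ofReal ?_) (Or.inr ENNReal.coe_ne_top)
    refine (Real.continuous_exp.tendsto _).comp (Tendsto.neg (Tendsto.const_mul _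
      (Tendsto.sub_const ?_ _)))
    refine intervalIntegral_tendsto_integral_Ioi _ (hF.integrableOn _ (by positivity)) ?_
    refine Tendsto.atTop_mul_const hδ (tendsto_natCast_atTop_atTop.comp ?_)
    exact tendsto_atTop_mono (fun m => by simp) tendsto_id
  have h1 : (Real.toNNReal (lam * δ) : ℝ≥0∞) * ENNReal.ofReal
        (Real.exp (-(lam * (kernelExponent F (k * δ) - δ)))) =
      ENNReal.ofReal (Real.exp (lam * δ)) * (ENNReal.ofReal lam * (ENNReal.ofReal δ *
        ENNReal.ofReal (Real.exp (-(lam * kernelExponent F (k * δ)))))) := by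
    rw [show (Real.toNNReal (lam * δ) : ℝ≥0∞) = ENNReal.ofReal (lam * δ) from rfl,
      ENNReal.ofReal_mul hlam.le,
      show -(lam * (kernelExponent F (k * δ) - δ)) =
        lam * δ + -(lam * kernelExponent F (k * δ)) by ring, Real.exp_add,
      ENNReal.ofReal_mul (Real.exp_pos _).le]
    ring
  rw [← h1]
  -- The infimum is below its value at each `m`, and as `m → ∞` the integral up to `(k + 1 + m) δ`
  -- exhausts the half-line.
  refine ge_of_tendsto' hlim fun m => (iInf_le _ m).trans (mul_le_mul_right
    (ENNReal.ofReal_le_ofReal (Real.exp_le_exp.2 (neg_le_neg ?_))) _)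
  rw [Real.coe_toNNReal _ (by positivity), mul_assoc]
  exact mul_le_mul_of_nonneg_left (hF.le_mul_sum_upper (by positivity) hδ _) hlam.le

theorem le_lintegral_palmSum_of_pos (hF : IsMonotoneKernel F) (hX : IsPoissonProcess P lam X)
    (hlam : 0 < lam) {δ : ℝ} (hδ : 0 < δ) :
    ENNReal.ofReal lam * ∫⁻ s in Ioi 0, ENNReal.ofReal (Real.exp (-(lam * kernelExponent F s))) ≤
      ENNReal.ofReal lam * ENNReal.ofReal δ + ENNReal.ofReal (Real.exp (lam * δ)) *
        ∫⁻ ω, palmSum F (fun i => X i ω) ∂P := by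
  have hc := hX.isPoissonCells hδ
  set y : ℕ → ℕ → ℝ := fun k l => F ((k + 1 : ℝ) * δ) (l * δ) with hy
  have hstep := hc.lintegral_step (y := y) (fun k l => hF.nonneg _ _ (by positivity) (by positivity))
    (fun k l => hF.le_one _ _ (by positivity) (by positivity))
  have hle : ∫⁻ ω, ∑' i, ⨅ s : Finset ℕ, ∏ j ∈ s.erase i,
        ENNReal.ofReal (y (annulusIndex δ (X i ω)) (annulusIndex δ (X j ω))) ∂P ≤
      ∫⁻ ω, palmSum F (fun i => X i ω) ∂P := by
    refine lintegral_mono fun ω => ENNReal.tsum_le_tsum fun i => iInf_mono fun s =>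
      Finset.prod_le_prod' fun j _ => ENNReal.ofReal_le_ofReal ?_
    have hi := (annulusIndex_eq_iff hδ (X i ω) _).1 rfl
    have hj := (annulusIndex_eq_iff hδ (X j ω) _).1 rfl
    exact (hF.anti_left _ _ _ (by positivity) hi.2.le (by positivity)).trans
      (hF.mono_right _ _ _ (by positivity) (by positivity) hj.1)
  refine (mul_le_mul_right (lintegral_le_add_tsum hδ
    (hF.antitoneOn_exp lam hlam.le) (hF.exp_zero_le_one lam hlam.le)) _).trans ?_
  rw [mul_add]
  refine add_le_add_right (le_trans ?_ (mul_le_mul_right (hstep.symm.trans_le hle) _)) _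
  rw [← ENNReal.tsum_mul_left, ← ENNReal.tsum_mul_left]
  refine ENNReal.tsum_le_tsum fun k => ?_
  have h1 : ENNReal.ofReal lam * (ENNReal.ofReal δ *
        ENNReal.ofReal (Real.exp (-(lam * kernelExponent F ((k + 1 : ℝ) * δ))))) =
      ENNReal.ofReal (Real.exp (lam * δ)) * ((Real.toNNReal (lam * δ) : ℝ≥0∞) * ENNReal.ofReal
        (Real.exp (-(lam * (kernelExponent F ((k + 1 : ℝ) * δ) + δ))))) := by
    rw [show (Real.toNNReal (lam * δ) : ℝ≥0∞) = ENNReal.ofReal (lam * δ) from rfl,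
      ENNReal.ofReal_mul hlam.le,
      show -(lam * kernelExponent F ((k + 1 : ℝ) * δ)) =
        lam * δ + -(lam * (kernelExponent F ((k + 1 : ℝ) * δ) + δ)) by ring, Real.exp_add,
      ENNReal.ofReal_mul (Real.exp_pos _).le]
    ring
  rw [h1]
  refine mul_le_mul_right (le_iInf fun m => mul_le_mul_right
    (ENNReal.ofReal_le_ofReal (Real.exp_le_exp.2 (neg_le_neg ?_))) _) _
  rw [Real.coe_toNNReal _ (by positivity), mul_assoc]
  exact mul_le_mul_of_nonneg_left (hF.mul_sum_lower_le (by positivity) hδ _) hlam.le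

/-- The Mecke formula combined with the Poisson probability generating functional; the errors in
both step bounds vanish as `δ → 0`. -/
theorem lintegral_palmSum (hF : IsMonotoneKernel F) (hX : IsPoissonProcess P lam X)
    (hlam : 0 < lam) :
    ∫⁻ ω, palmSum F (fun i => X i ω) ∂P = ENNReal.ofReal lam *
      ∫⁻ s in Ioi 0, ENNReal.ofReal (Real.exp (-(lam * kernelExponent F s))) := by
  have hδ0 : Tendsto (fun δ : ℝ => ENNReal.ofReal δ) (𝓝[>] 0) (𝓝 0) := by
    have := (ENNReal.continuous_ofReal.tendsto 0).mono_left (nhdsWithin_le_nhds (s := Ioi 0))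
    simpa using this
  have hexp : Tendsto (fun δ : ℝ => ENNReal.ofReal (Real.exp (lam * δ))) (𝓝[>] 0) (𝓝 1) := by
    have hcont : Continuous fun δ : ℝ => ENNReal.ofReal (Real.exp (lam * δ)) :=
      ENNReal.continuous_ofReal.comp (by fun_prop)
    have := (hcont.tendsto 0).mono_left (nhdsWithin_le_nhds (s := Ioi 0))
    simpa using this
  refine le_antisymm ?_ ?_
  · set R := ∫⁻ s in Ioi 0, ENNReal.ofReal (Real.exp (-(lam * kernelExponent F s)))
    have hlim := ENNReal.Tendsto.mul hexp (Or.inl one_ne_zero)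
      (ENNReal.Tendsto.const_mul (hδ0.add_const R) (Or.inr (ENNReal.ofReal_ne_top (r := lam))))
      (Or.inr ENNReal.one_ne_top)
    rw [one_mul, zero_add] at hlim
    exact ge_of_tendsto hlim (eventually_nhdsWithin_of_forall fun δ hδ =>
      lintegral_palmSum_le_of_pos hF hX hlam hδ)
  · set M := ∫⁻ ω, palmSum F (fun i => X i ω) ∂P
    have hlim := (ENNReal.Tendsto.const_mul hδ0 (Or.inr (ENNReal.ofReal_ne_top (r := lam)))).add
      (ENNReal.Tendsto.mul_const hexp (Or.inl one_ne_zero) (b := M))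
    rw [one_mul, mul_zero, zero_add] at hlim
    exact ge_of_tendsto hlim (eventually_nhdsWithin_of_forall fun δ hδ =>
      le_lintegral_palmSum_of_pos hF hX hlam hδ)

end Mecke

/-! ### The exponential function of an extended nonnegative number -/

/-- `exp (-s)` for `s ∈ [0, ∞]`. -/
noncomputable def expNeg (s : ℝ≥0∞) : ℝ≥0∞ := EReal.exp (-(s : EReal))

theorem expNeg_top : expNeg ∞ = 0 := by simp [expNeg]

theorem expNeg_zero : expNeg 0 = 1 := by simp [expNeg]

theorem expNeg_ofReal {x : ℝ} (hx : 0 ≤ x) :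
    expNeg (ENNReal.ofReal x) = ENNReal.ofReal (Real.exp (-x)) := by
  rw [expNeg, EReal.coe_ennreal_ofReal, max_eq_left hx, ← EReal.coe_neg, EReal.exp_coe]

theorem expNeg_le_one (s : ℝ≥0∞) : expNeg s ≤ 1 := by
  simp [expNeg, EReal.exp_le_one_iff, EReal.coe_ennreal_nonneg]

theorem antitone_expNeg : Antitone expNeg := fun _ _ h =>
  EReal.exp_monotone (EReal.neg_le_neg_iff.2 (EReal.coe_ennreal_le_coe_ennreal_iff.2 h))

theorem continuous_expNeg : Continuous expNeg :=
  ENNReal.continuous_exp.comp (continuous_neg.comp continuous_coe_ennreal_ereal)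

theorem expNeg_add (a b : ℝ≥0∞) : expNeg (a + b) = expNeg a * expNeg b := by
  have h : ∀ c : ℝ≥0∞, EReal.exp c ≠ 0 := fun c => by
    rw [Ne, EReal.exp_eq_zero_iff]
    exact EReal.coe_ennreal_ne_bot c
  rw [expNeg, expNeg, expNeg, EReal.exp_neg, EReal.exp_neg, EReal.exp_neg, EReal.coe_ennreal_add,
    EReal.exp_add, ENNReal.mul_inv (Or.inl (h a)) (Or.inr (h b))]

theorem expNeg_sum {ι : Type*} (s : Finset ι) (u : ι → ℝ≥0∞) :
    expNeg (∑ j ∈ s, u j) = ∏ j ∈ s, expNeg (u j) := by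
  classical
  induction s using Finset.induction_on with
  | empty => simp [expNeg_zero]
  | insert a s ha ih => rw [Finset.sum_insert ha, Finset.prod_insert ha, expNeg_add, ih]

/-- A continuous antitone map turns the supremum of partial sums into an infimum; this is the source
of the infima of finite products. -/
theorem expNeg_tsum (u : ℕ → ℝ≥0∞) :
    expNeg (∑' j, u j) = ⨅ s : Finset ℕ, ∏ j ∈ s, expNeg (u j) := by
  rw [ENNReal.tsum_eq_iSup_sum,
    Antitone.map_ciSup_of_continuousAt continuous_expNeg.continuousAt antitone_expNeg]
  simp only [expNeg_sum]

/-! ### The exponential distribution -/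

theorem expMeasure_lt_ofReal (s : ℝ≥0∞) :
    expMeasure 1 {y | s < ENNReal.ofReal y} = expNeg s := by
  have := isProbabilityMeasure_expMeasure one_pos
  induction s using ENNReal.recTopCoe with
  | top => simp [expNeg_top]
  | coe r =>
    have hset : {y : ℝ | (r : ℝ≥0∞) < ENNReal.ofReal y} = (Iic (r : ℝ))ᶜ := by
      ext y
      rw [mem_ofPred_eq, ← ENNReal.ofReal_coe_nnreal, ENNReal.ofReal_lt_ofReal_iff', mem_compl_iff,
        mem_Iic, not_le]
      exact ⟨fun h => h.1, fun h => ⟨h, r.2.trans_lt h⟩⟩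
    have hcdf := cdf_expMeasure_eq one_pos (r : ℝ)
    rw [if_pos r.coe_nonneg, cdf_eq_real, one_mul] at hcdf
    have hexp := expNeg_ofReal r.coe_nonneg
    rw [ENNReal.ofReal_coe_nnreal] at hexp
    rw [hset, hexp, ← ofReal_measureReal,
      probReal_compl_eq_one_sub measurableSet_Iic, hcdf, sub_sub_cancel]

/-- Tilting the `exp(1)` density by `exp (-w y)` gives `1 / (1 + w)` times the `exp(1 + w)` density.
-/
theorem lintegral_expMeasure_expNeg {w : ℝ} (hw : 0 ≤ w) :
    ∫⁻ y, expNeg (ENNReal.ofReal y * ENNReal.ofReal w) ∂(expMeasure 1) =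
      ENNReal.ofReal (1 / (1 + w)) := by
  have h1 : expMeasure 1 = volume.withDensity (exponentialPDF 1) := rfl
  have hm : Measurable fun y => expNeg (ENNReal.ofReal y * ENNReal.ofReal w) :=
    continuous_expNeg.measurable.comp (by fun_prop)
  have hpdf : ∀ r, Measurable (exponentialPDF r) := fun r =>
    (measurable_exponentialPDFReal r).ennreal_ofReal
  rw [h1, lintegral_withDensity_eq_lintegral_mul _ (hpdf 1) hm]
  have h2 : ∀ y, (exponentialPDF 1 * fun y => expNeg (ENNReal.ofReal y * ENNReal.ofReal w)) y =
      ENNReal.ofReal (1 / (1 + w)) * exponentialPDF (1 + w) y := by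
    intro y
    rw [Pi.mul_apply]
    rcases lt_or_ge y 0 with hy | hy
    · rw [exponentialPDF_of_neg hy, exponentialPDF_of_neg hy, zero_mul, mul_zero]
    · rw [exponentialPDF_of_nonneg hy, exponentialPDF_of_nonneg hy, ← ENNReal.ofReal_mul hy,
        expNeg_ofReal (by positivity), ← ENNReal.ofReal_mul (by positivity),
        ← ENNReal.ofReal_mul (by positivity)]
      congr 1
      rw [one_mul, one_mul, ← Real.exp_add, ← mul_assoc, one_div_mul_cancel (by positivity),
        one_mul]
      congr 1
      ring
  simp only [h2]
  rw [lintegral_const_mul _ (hpdf _), lintegral_exponentialPDF_eq_one (by positivity), mul_one]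

/-! ### Coverage given the locations of the base stations -/

section Fading

variable {Ω : Type*} [MeasurableSpace Ω] {P : Measure Ω} {g : ℕ → Ω → ℝ}

theorem indepFun_tsum_erase (hg : ∀ j, Measurable (g j)) (hind : iIndepFun g P)
    (i : ℕ) {f : ℕ → ℝ → ℝ≥0∞} (hf : ∀ j, Measurable (f j)) :
    IndepFun (fun ω => ∑' j, if j = i then 0 else f j (g j ω)) (g i) P := by
  have hind' : iIndep (fun j => MeasurableSpace.comap (g j) inferInstance) P := hind
  have h := indep_iSup_of_disjoint (fun j => (hg j).comap_le) hind' (S := {i}ᶜ) (T := {i})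
    disjoint_compl_left
  refine indep_of_indep_of_le_left (indep_of_indep_of_le_right h ?_) ?_
  · exact le_iSup₂_of_le i rfl le_rfl
  · refine Measurable.comap_le ?_
    -- Measurability is required for the σ-algebra generated by the gains other than `g i`, not for
    -- the ambient one.
    refine @Measurable.tsum Ω ℝ≥0∞ ℕ (_) _ _ _ _ _ _ _ _ _ _ _ _ fun j => ?_
    by_cases hj : j = i
    · simp only [hj, if_true]
      exact measurable_const
    · simp only [hj, if_false]
      have hle : MeasurableSpace.comap (g j) inferInstance ≤
          ⨆ k ∈ ({i}ᶜ : Set ℕ), MeasurableSpace.comap (g k) inferInstance :=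
        le_iSup₂_of_le j hj le_rfl
      exact ((hf j).comp (comap_measurable (g j))).mono hle le_rfl

/-- The sum `S` is independent of `g i`, whose tail at `S` is `exp (-S)`. Hence the probability is
`E exp (-S)`, which factors over the independent gains. -/
theorem measure_tsum_lt_fading [IsProbabilityMeasure P] (hg : ∀ j, Measurable (g j))
    (hlaw : ∀ j, P.map (g j) = expMeasure 1) (hind : iIndepFun g P) (i : ℕ) {w : ℕ → ℝ}
    (hw : ∀ j, 0 ≤ w j) :
    P {ω | (∑' j, if j = i then 0 else ENNReal.ofReal (g j ω) * ENNReal.ofReal (w j)) <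
      ENNReal.ofReal (g i ω)} =
      ⨅ s : Finset ℕ, ∏ j ∈ s.erase i, ENNReal.ofReal (1 / (1 + w j)) := by
  have := isProbabilityMeasure_expMeasure one_pos
  have hf : ∀ j, Measurable fun y : ℝ => ENNReal.ofReal y * ENNReal.ofReal (w j) := fun j => by
    fun_prop
  set u : ℕ → ℝ → ℝ≥0∞ := fun j y => if j = i then 0 else ENNReal.ofReal y * ENNReal.ofReal (w j)
    with hu
  have hum : ∀ j, Measurable (u j) := fun j => by
    simp only [hu]
    split_ifs
    exacts [measurable_const, hf j]
  set S : Ω → ℝ≥0∞ := fun ω => ∑' j, u j (g j ω) with hS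
  have hSm : Measurable S := Measurable.tsum fun j => (hum j).comp (hg j)
  have hSi : IndepFun S (g i) P := indepFun_tsum_erase hg hind i hf
  have hprod := (indepFun_iff_map_prod_eq_prod_map_map hSm.aemeasurable (hg i).aemeasurable).1 hSi
  have hset : MeasurableSet {p : ℝ≥0∞ × ℝ | p.1 < ENNReal.ofReal p.2} :=
    measurableSet_lt measurable_fst measurable_snd.ennreal_ofReal
  have h1 : P {ω | S ω < ENNReal.ofReal (g i ω)} = ∫⁻ ω, expNeg (S ω) ∂P := by
    have : {ω | S ω < ENNReal.ofReal (g i ω)} =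
        (fun ω => (S ω, g i ω)) ⁻¹' {p : ℝ≥0∞ × ℝ | p.1 < ENNReal.ofReal p.2} := rfl
    rw [this, ← Measure.map_apply (hSm.prodMk (hg i)) hset, hprod, hlaw,
      Measure.prod_apply hset]
    have h2 : ∀ s : ℝ≥0∞, expMeasure 1 (Prod.mk s ⁻¹' {p : ℝ≥0∞ × ℝ | p.1 < ENNReal.ofReal p.2}) =
        expNeg s := fun s => expMeasure_lt_ofReal s
    simp only [h2]
    rw [lintegral_map continuous_expNeg.measurable hSm]
  have huE : ∀ j, Measurable fun ω => expNeg (u j (g j ω)) := fun j =>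
    continuous_expNeg.measurable.comp ((hum j).comp (hg j))
  have hfac : ∀ s : Finset ℕ, ∫⁻ ω, ∏ j ∈ s, expNeg (u j (g j ω)) ∂P =
      ∏ j ∈ s.erase i, ENNReal.ofReal (1 / (1 + w j)) := by
    intro s
    rw [lintegral_prod_eq_prod_lintegral_of_indepFun s (fun j ω => expNeg (u j (g j ω)))
      (hind.comp (fun j y => expNeg (u j y))
        fun j => continuous_expNeg.measurable.comp (hum j)) huE]
    symm
    refine Finset.prod_subset_one_on_sdiff (Finset.erase_subset i s) (fun j hj => ?_)
      (fun j hj => ?_)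
    · have hji : j = i := by
        by_contra h
        exact (Finset.mem_sdiff.1 hj).2 (Finset.mem_erase.2 ⟨h, (Finset.mem_sdiff.1 hj).1⟩)
      simp [hu, hji, expNeg_zero]
    · simp only [hu, (Finset.mem_erase.1 hj).1, if_false]
      rw [← lintegral_map (f := fun y => expNeg (ENNReal.ofReal y * ENNReal.ofReal (w j)))
        (continuous_expNeg.measurable.comp (hf j)) (hg j), hlaw,
        lintegral_expMeasure_expNeg (hw j)]
  change P {ω | S ω < ENNReal.ofReal (g i ω)} = _
  rw [h1]
  simp only [hS, expNeg_tsum]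
  rw [lintegral_iInf_directed_of_measurable (IsProbabilityMeasure.ne_zero P)
    (fun s => Finset.measurable_fun_prod _ fun j _ => huE j)]
  · exact iInf_congr hfac
  · intro s
    rw [hfac]
    exact ENNReal.prod_ne_top fun j _ => ENNReal.ofReal_ne_top
  · refine Antitone.directed_ge fun s t hst ω => ?_
    exact Finset.prod_le_prod_of_subset_of_le_one' hst fun j _ _ => expNeg_le_one _

end Fading

/-! ### From the SIR event to a product over interferers -/

theorem pathLoss_pos {h : ℝ} (hh : 0 < h) (α r : ℝ) : 0 < pathLoss α h r :=
  Real.rpow_pos_of_pos (by positivity) _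

theorem lt_sir_iff {Ω : Type*} {α h θ : ℝ} (hh : 0 < h) (hθ : 0 < θ) (X : ℕ → Ω → Plane)
    (g : ℕ → Ω → ℝ) (i : ℕ) (ω : Ω) :
    ENNReal.ofReal θ < sir α h X g i ω ↔
      (∑' j, if j = i then 0 else ENNReal.ofReal (g j ω) *
        ENNReal.ofReal (θ * (pathLoss α h ‖X j ω‖ / pathLoss α h ‖X i ω‖))) <
      ENNReal.ofReal (g i ω) := by
  have hL := fun j => pathLoss_pos hh α ‖X j ω‖
  have hθ0 : ENNReal.ofReal θ ≠ 0 := by simpa using hθ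
  have hLi0 : ENNReal.ofReal (pathLoss α h ‖X i ω‖) ≠ 0 := by simpa using hL i
  have hint : interference α h X g i ω =
      ∑' j, if j = i then 0 else rxPower α h X g j ω := by
    refine (tsum_subtype {j | j ≠ i} fun j => rxPower α h X g j ω).trans ?_
    refine tsum_congr fun j => ?_
    by_cases hj : j = i <;> simp [hj]
  -- Clearing the denominator is legitimate even for interference 0 or `∞`, because `θ` is neither 0
  -- nor `∞`.
  rw [sir, ENNReal.lt_div_iff_mul_lt (Or.inr ENNReal.ofReal_ne_top) (Or.inr hθ0), rxPower,
    ENNReal.ofReal_mul' (hL i).le, ← ENNReal.div_lt_iff (Or.inl hLi0)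
      (Or.inl ENNReal.ofReal_ne_top), hint, ← ENNReal.tsum_mul_left, div_eq_mul_inv,
    ← ENNReal.tsum_mul_right]
  refine iff_of_eq (congrArg (· < _) (tsum_congr fun j => ?_))
  by_cases hj : j = i
  · simp [hj]
  · simp only [hj, if_false]
    rw [rxPower, ENNReal.ofReal_mul' (hL j).le, ENNReal.ofReal_mul hθ.le,
      ENNReal.ofReal_div_of_pos (hL i), div_eq_mul_inv]
    ring

theorem measurable_rxPower {Ω : Type*} [MeasurableSpace Ω] {X : ℕ → Ω → Plane} {g : ℕ → Ω → ℝ}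
    (hX : ∀ i, Measurable (X i)) (hg : ∀ i, Measurable (g i)) (α h : ℝ) (i : ℕ) :
    Measurable (rxPower α h X g i) := by
  have := hX i
  have := hg i
  unfold rxPower pathLoss
  fun_prop

theorem measurable_sir {Ω : Type*} [MeasurableSpace Ω] {X : ℕ → Ω → Plane} {g : ℕ → Ω → ℝ}
    (hX : ∀ i, Measurable (X i)) (hg : ∀ i, Measurable (g i)) (α h : ℝ) (i : ℕ) :
    Measurable (sir α h X g i) :=
  (measurable_rxPower hX hg α h i).div
    (Measurable.tsum fun j => measurable_rxPower hX hg α h j)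

/-- Fubini for independent locations and gains: freeze the locations and apply
`measure_tsum_lt_fading`. The event `B` on locations later expresses that station `i` is the
closest. -/
theorem IsRayleighNetwork.measure_lt_sir {Ω : Type*} [MeasurableSpace Ω] {P : Measure Ω}
    {lam α h θ : ℝ} {X : ℕ → Ω → Plane} {g : ℕ → Ω → ℝ} (hN : IsRayleighNetwork P lam X g)
    (hh : 0 < h) (hθ : 0 < θ) (i : ℕ) {B : Set (ℕ → Plane)} (hB : MeasurableSet B) :
    P {ω | (fun j => X j ω) ∈ B ∧ ENNReal.ofReal θ < sir α h X g i ω} =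
      ∫⁻ ω, B.indicator (fun x => ⨅ s : Finset ℕ, ∏ j ∈ s.erase i, ENNReal.ofReal
        (1 / (1 + θ * (pathLoss α h ‖x j‖ / pathLoss α h ‖x i‖)))) (fun j => X j ω) ∂P := by
  have := hN.isProbabilityMeasure
  have hX := hN.poisson.measurable
  have hXm : Measurable fun ω j => X j ω := measurable_pi_iff.2 hX
  have hgm : Measurable fun ω j => g j ω := measurable_pi_iff.2 hN.fading_measurable
  set A : Set ((ℕ → Plane) × (ℕ → ℝ)) := {p | p.1 ∈ B ∧
    ENNReal.ofReal θ < sir α h (fun j q => q.1 j) (fun j q => q.2 j) i p} with hA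
  have hAm : MeasurableSet A := by
    have hs : Measurable (sir α h (fun j (q : (ℕ → Plane) × (ℕ → ℝ)) => q.1 j)
        (fun j q => q.2 j) i) :=
      measurable_sir (fun j => (measurable_pi_apply j).comp measurable_fst)
        (fun j => (measurable_pi_apply j).comp measurable_snd) α h i
    exact (measurable_fst hB).inter (measurableSet_lt measurable_const hs)
  have hprod := (indepFun_iff_map_prod_eq_prod_map_map hXm.aemeasurable hgm.aemeasurable).1
    hN.marks_indep
  have hpre : {ω | (fun j => X j ω) ∈ B ∧ ENNReal.ofReal θ < sir α h X g i ω} =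
      (fun ω => ((fun j => X j ω), (fun j => g j ω))) ⁻¹' A := rfl
  have hgprob : IsProbabilityMeasure (P.map fun ω j => g j ω) :=
    Measure.isProbabilityMeasure_map hgm.aemeasurable
  have hpl : ∀ r, 0 < pathLoss α h r := fun r => pathLoss_pos hh α r
  have hsec : ∀ x : ℕ → Plane, (P.map fun ω j => g j ω) (Prod.mk x ⁻¹' A) =
      B.indicator (fun x => ⨅ s : Finset ℕ, ∏ j ∈ s.erase i, ENNReal.ofReal
        (1 / (1 + θ * (pathLoss α h ‖x j‖ / pathLoss α h ‖x i‖)))) x := by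
    intro x
    rw [Measure.map_apply hgm (measurable_prodMk_left hAm)]
    by_cases hx : x ∈ B
    · rw [indicator_of_mem hx, ← measure_tsum_lt_fading hN.fading_measurable hN.fading_law
        hN.fading_indep i fun j => mul_nonneg hθ.le (div_nonneg (hpl _).le (hpl _).le)]
      congr 1
      ext ω
      change (x ∈ B ∧ _) ↔ _
      rw [lt_sir_iff hh hθ]
      exact ⟨fun h => h.2, fun h => ⟨hx, h⟩⟩
    · rw [indicator_of_notMem hx]
      have : (fun ω j => g j ω) ⁻¹' (Prod.mk x ⁻¹' A) = ∅ := by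
        ext ω
        simp [hA, hx]
      rw [this, measure_empty]
  have hmeas : Measurable (B.indicator (fun x : ℕ → Plane => ⨅ s : Finset ℕ, ∏ j ∈ s.erase i,
      ENNReal.ofReal (1 / (1 + θ * (pathLoss α h ‖x j‖ / pathLoss α h ‖x i‖))))) := by
    refine Measurable.indicator (measurable_iInf_prod_erase (fun j => ?_) i) hB
    unfold pathLoss
    fun_prop
  rw [hpre, ← Measure.map_apply (hXm.prodMk hgm) hAm, hprod, Measure.prod_apply hAm]
  simp only [hsec]
  rw [lintegral_map hmeas hXm]

/-! ### The profile `θ / (v ^ a + θ)` and its tail integrals -/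

/-- The function `v ↦ θ / (v ^ a + θ)`. -/
noncomputable def profile (θ a v : ℝ) : ℝ := θ * (v ^ a + θ)⁻¹

/-- The integral of `profile θ a` over `(y, ∞)`. -/
noncomputable def profileTail (θ a y : ℝ) : ℝ := ∫ v in Ioi y, profile θ a v

theorem profile_nonneg {θ a v : ℝ} (hθ : 0 < θ) (hv : 0 ≤ v) : 0 ≤ profile θ a v := by
  have := Real.rpow_nonneg hv a
  unfold profile
  positivity

theorem profile_pos {θ a v : ℝ} (hθ : 0 < θ) (hv : 0 ≤ v) : 0 < profile θ a v := by
  have := Real.rpow_nonneg hv a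
  unfold profile
  positivity

theorem profile_le_one {θ a v : ℝ} (hθ : 0 < θ) (hv : 0 ≤ v) : profile θ a v ≤ 1 := by
  have := Real.rpow_nonneg hv a
  rw [profile, ← div_eq_mul_inv, div_le_one (by positivity)]
  linarith

theorem measurable_profile (θ a : ℝ) : Measurable (profile θ a) := by
  unfold profile
  fun_prop

theorem integrableOn_profile_Ioc {θ a y z : ℝ} (hθ : 0 < θ) (hy : 0 ≤ y) :
    IntegrableOn (profile θ a) (Ioc y z) := by
  refine Measure.integrableOn_of_bounded (M := 1) (by simp)
    (measurable_profile θ a).aestronglyMeasurable ?_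
  refine (ae_restrict_iff' measurableSet_Ioc).2 (ae_of_all _ fun v hv => ?_)
  have hv0 : 0 ≤ v := hy.trans hv.1.le
  rw [Real.norm_of_nonneg (profile_nonneg hθ hv0)]
  exact profile_le_one hθ hv0

theorem integrableOn_profile {θ a y : ℝ} (hθ : 0 < θ) (ha : 1 < a) (hy : 0 ≤ y) :
    IntegrableOn (profile θ a) (Ioi y) := by
  have h1 : IntegrableOn (profile θ a) (Ioi 1) := by
    have := (integrableOn_inv_rpow_sub ha (x := -θ) (by linarith)).const_mul θ
    simp only [sub_neg_eq_add] at this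
    exact this
  have h2 := (integrableOn_profile_Ioc (a := a) (z := 1) hθ hy).union h1
  exact h2.mono_set fun v hv => (le_or_gt v 1).imp (fun h => ⟨hv, h⟩) id

theorem profileTail_anti {θ a y z : ℝ} (hθ : 0 < θ) (ha : 1 < a) (hy : 0 ≤ y) (h : y ≤ z) :
    profileTail θ a z ≤ profileTail θ a y := by
  refine setIntegral_mono_set (integrableOn_profile hθ ha hy) ?_
    (Ioi_subset_Ioi h).eventuallyLE
  exact (ae_restrict_iff' measurableSet_Ioi).2 (ae_of_all _ fun v hv =>
    profile_nonneg hθ (hy.trans (le_of_lt hv)))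

/-- The profile is at most 1, so removing `(0, y]` loses at most `y`. -/
theorem profileTail_zero_sub_le {θ a y : ℝ} (hθ : 0 < θ) (ha : 1 < a) (hy : 0 ≤ y) :
    profileTail θ a 0 - y ≤ profileTail θ a y := by
  have h1 : profileTail θ a 0 = (∫ v in Ioc 0 y, profile θ a v) + profileTail θ a y := by
    rw [profileTail, profileTail, ← setIntegral_union (Ioc_disjoint_Ioi le_rfl) measurableSet_Ioi
      (integrableOn_profile_Ioc hθ le_rfl) (integrableOn_profile hθ ha hy), Ioc_union_Ioi_eq_Ioi hy]
  have h2 : ∫ v in Ioc 0 y, profile θ a v ≤ ∫ v in Ioc 0 y, (1 : ℝ) :=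
    setIntegral_mono_on (integrableOn_profile_Ioc hθ le_rfl) (by simp) measurableSet_Ioc
      fun v hv => profile_le_one hθ hv.1.le
  simp only [integral_const, MeasurableSet.univ, measureReal_restrict_apply, univ_inter,
    Real.volume_real_Ioc_of_le hy, sub_zero, smul_eq_mul, mul_one] at h2
  linarith

theorem profileTail_pos {θ a y : ℝ} (hθ : 0 < θ) (ha : 1 < a) (hy : 0 ≤ y) :
    0 < profileTail θ a y := by
  rw [profileTail, setIntegral_pos_iff_support_of_nonneg_ae
    ((ae_restrict_iff' measurableSet_Ioi).2 (ae_of_all _ fun v hv =>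
      profile_nonneg hθ (hy.trans (le_of_lt hv)))) (integrableOn_profile hθ ha hy)]
  have : Function.support (profile θ a) ∩ Ioi y = Ioi y :=
    inter_eq_right.2 fun v hv => (profile_pos hθ (hy.trans (le_of_lt hv))).ne'
  rw [this, Real.volume_Ioi]
  exact ENNReal.zero_lt_top

theorem eta_eq_profileTail {α θ : ℝ} (hα : 2 < α) (hθ : 0 < θ) :
    eta α θ 1 1 = 1 + profileTail θ (α / 2) 1 := by
  rw [eta_one_eq hα (by simpa using hθ.le), Real.one_rpow, div_one]
  rfl

/-! ### Substitutions -/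

theorem image_affine_Ioi {u : ℝ} (hu : 0 < u) (A c : ℝ) :
    (fun t => (t + c) / u) '' Ioi A = Ioi ((A + c) / u) := by
  ext v
  constructor
  · rintro ⟨t, ht, rfl⟩
    have : A < t := ht
    exact mem_Ioi.2 ((div_lt_div_iff_of_pos_right hu).2 (by linarith))
  · intro hv
    refine ⟨v * u - c, ?_, ?_⟩
    · have := (div_lt_iff₀ hu).1 (mem_Ioi.1 hv)
      exact mem_Ioi.2 (by linarith)
    · simp only [sub_add_cancel]
      field_simp

theorem hasDerivWithinAt_affine (c u t : ℝ) (s : Set ℝ) :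
    HasDerivWithinAt (fun t => (t + c) / u) (1 / u) s t :=
  (((hasDerivAt_id t).add_const c).div_const u).hasDerivWithinAt

theorem injOn_affine {u : ℝ} (hu : 0 < u) (c : ℝ) (s : Set ℝ) :
    InjOn (fun t => (t + c) / u) s := fun x _ y _ h => by
  simp only at h
  field_simp at h
  linarith

theorem integral_Ioi_comp_affine {u : ℝ} (hu : 0 < u) (A c : ℝ) (f : ℝ → ℝ) :
    ∫ t in Ioi A, f ((t + c) / u) = u * ∫ v in Ioi ((A + c) / u), f v := by
  rw [← image_affine_Ioi hu, integral_image_eq_integral_abs_deriv_smul measurableSet_Ioi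
    (fun t _ => hasDerivWithinAt_affine c u t _) (injOn_affine hu c _), ← integral_const_mul]
  refine setIntegral_congr_fun measurableSet_Ioi fun t _ => ?_
  simp only [abs_of_pos (one_div_pos.2 hu), smul_eq_mul]
  field_simp

theorem integrableOn_Ioi_comp_affine {u : ℝ} (hu : 0 < u) (A c : ℝ) {f : ℝ → ℝ}
    (hf : IntegrableOn f (Ioi ((A + c) / u))) :
    IntegrableOn (fun t => f ((t + c) / u)) (Ioi A) := by
  rw [← image_affine_Ioi hu, integrableOn_image_iff_integrableOn_abs_deriv_smul measurableSet_Ioi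
    (fun t _ => hasDerivWithinAt_affine c u t _) (injOn_affine hu c _)] at hf
  refine IntegrableOn.congr_fun (hf.const_mul u) (fun t _ => ?_) measurableSet_Ioi
  simp only [abs_of_pos (one_div_pos.2 hu), smul_eq_mul]
  field_simp

/-! ### The kernel of the strongest base station -/

/-- The probability that a signal from squared distance `s / π` exceeds `θ` times a signal from
squared distance `t / π`, where `c = π h ^ 2` and `a = α / 2`. -/
noncomputable def sirKernel (θ a c s t : ℝ) : ℝ := 1 / (1 + θ * ((s + c) / (t + c)) ^ a)

/-- The kernel depends only on the ratio `(t + c) / (s + c)`, so its exponent is a rescaled tail of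
a single profile. -/
theorem one_sub_sirKernel {θ a c s t : ℝ} (hθ : 0 < θ) (hc : 0 < c) (hs : 0 ≤ s) (ht : 0 ≤ t) :
    1 - sirKernel θ a c s t = profile θ a ((t + c) / (s + c)) := by
  have h1 : 0 < (t + c) / (s + c) := by positivity
  have h2 : 0 < ((t + c) / (s + c)) ^ a := Real.rpow_pos_of_pos h1 a
  rw [sirKernel, profile, ← inv_div (t + c) (s + c), Real.inv_rpow h1.le]
  field_simp
  ring

theorem isMonotoneKernel_sirKernel {θ a c : ℝ} (hθ : 0 < θ) (ha : 1 < a) (hc : 0 < c) :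
    IsMonotoneKernel (sirKernel θ a c) := by
  have hpow : ∀ s t, 0 ≤ s → 0 ≤ t → 0 ≤ ((s + c) / (t + c)) ^ a := fun s t hs ht =>
    Real.rpow_nonneg (by positivity) a
  refine ⟨fun s t hs ht => ?_, fun s t hs ht => ?_, fun s s' t hs h ht => ?_,
    fun s t t' hs ht h => ?_, fun s hs => ?_⟩
  · have := hpow s t hs ht
    unfold sirKernel
    positivity
  · have := hpow s t hs ht
    rw [sirKernel, div_le_one (by positivity)]
    nlinarith
  · have h1 := hpow s t hs ht
    unfold sirKernel
    have : 0 ≤ (s + c) / (t + c) := by positivity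
    gcongr
  · have h1 := hpow s t' hs (ht.trans h)
    unfold sirKernel
    have : 0 ≤ (s + c) / (t' + c) := by have := ht.trans h; positivity
    gcongr
  · have h1 : IntegrableOn (fun t => profile θ a ((t + c) / (s + c))) (Ioi 0) :=
      integrableOn_Ioi_comp_affine (by positivity) 0 c (integrableOn_profile hθ ha (by positivity))
    exact h1.congr_fun (fun t ht => (one_sub_sirKernel hθ hc hs (le_of_lt ht)).symm)
      measurableSet_Ioi

theorem kernelExponent_sirKernel {θ a c s : ℝ} (hθ : 0 < θ) (hc : 0 < c) (hs : 0 ≤ s) :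
    kernelExponent (sirKernel θ a c) s = (s + c) * profileTail θ a (c / (s + c)) := by
  rw [kernelExponent, setIntegral_congr_fun measurableSet_Ioi
    (fun t ht => one_sub_sirKernel hθ hc hs (le_of_lt ht)),
    integral_Ioi_comp_affine (by positivity), zero_add]
  rfl

/-! ### Restriction of a kernel to the more distant points -/

open Classical in
/-- The kernel `F` restricted to `s < t`, or to `s ≤ t` if `e` holds. -/
noncomputable def farKernel (e : Prop) (F : ℝ → ℝ → ℝ) (s t : ℝ) : ℝ :=
  if s < t ∨ (e ∧ s = t) then F s t else 0

/-- The region kept shrinks as `s` grows and expands as `t` grows, and the value 0 outside it lies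
below `F`; both monotonicities survive. Integrability survives since only a bounded interval of `t`
is altered. -/
theorem isMonotoneKernel_farKernel (e : Prop) {F : ℝ → ℝ → ℝ} (hF : IsMonotoneKernel F) :
    IsMonotoneKernel (farKernel e F) := by
  have hnn : ∀ s t, 0 ≤ s → 0 ≤ t → 0 ≤ farKernel e F s t := fun s t hs ht => by
    unfold farKernel
    split_ifs
    exacts [hF.nonneg s t hs ht, le_rfl]
  refine ⟨hnn, fun s t hs ht => ?_, fun s s' t hs h ht => ?_, fun s t t' hs ht h => ?_,
    fun s hs => ?_⟩
  · unfold farKernel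
    split_ifs
    exacts [hF.le_one s t hs ht, zero_le_one]
  · by_cases h' : s' < t ∨ (e ∧ s' = t)
    · have h'' : s < t ∨ (e ∧ s = t) := by
        rcases h' with h' | ⟨he, h'⟩
        · exact Or.inl (h.trans_lt h')
        · exact (h.trans_eq h').lt_or_eq.imp id fun h => ⟨he, h⟩
      rw [farKernel, farKernel, if_pos h', if_pos h'']
      exact hF.anti_left s s' t hs h ht
    · rw [farKernel, if_neg h']
      exact hnn s t hs ht
  · by_cases h' : s < t ∨ (e ∧ s = t)
    · have h'' : s < t' ∨ (e ∧ s = t') := by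
        rcases h' with h' | ⟨he, h'⟩
        · exact Or.inl (h'.trans_le h)
        · exact (h'.le.trans h).lt_or_eq.imp id fun h => ⟨he, h⟩
      rw [farKernel, farKernel, if_pos h', if_pos h'']
      exact hF.mono_right s t t' hs ht h
    · rw [farKernel, if_neg h']
      exact hnn s t' hs (ht.trans h)
  · have h1 : IntegrableOn (fun t => 1 - farKernel e F s t) (Ioo 0 s) := by
      refine (integrableOn_const (C := (1 : ℝ)) (by simp)).congr_fun (fun t ht => ?_)
        measurableSet_Ioo
      rw [farKernel, if_neg, sub_zero]
      rintro (h | ⟨-, h⟩)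
      · exact lt_asymm h ht.2
      · exact h.not_gt ht.2
    have h2 : IntegrableOn (fun t => 1 - farKernel e F s t) (Ioi s) := by
      refine ((hF.integrableOn s hs).mono_set (Ioi_subset_Ioi hs)).congr_fun (fun t ht => ?_)
        measurableSet_Ioi
      simp only [farKernel, if_pos (Or.inl ht : s < t ∨ (e ∧ s = t))]
    have h3 : IntegrableOn (fun t => 1 - farKernel e F s t) {s} := by simp
    refine ((h1.union h3).union h2).mono_set fun t ht => ?_
    rcases lt_trichotomy t s with h | h | h
    · exact Or.inl (Or.inl ⟨ht, h⟩)
    · exact Or.inl (Or.inr h)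
    · exact Or.inr h

/-- The excluded range `t < s` contributes `s`, the exponent of the probability that no station is
nearer. The tie `t = s` is a null set, so `e` plays no role. -/
theorem kernelExponent_farKernel (e : Prop) {F : ℝ → ℝ → ℝ} (hF : IsMonotoneKernel F) {s : ℝ}
    (hs : 0 ≤ s) : kernelExponent (farKernel e F) s = s + ∫ t in Ioi s, (1 - F s t) := by
  have hint := (isMonotoneKernel_farKernel e hF).integrableOn s hs
  rw [kernelExponent, ← Ioc_union_Ioi_eq_Ioi hs, setIntegral_union (Ioc_disjoint_Ioi le_rfl)
    measurableSet_Ioi (hint.mono_set Ioc_subset_Ioi_self)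
    (hint.mono_set (Ioi_subset_Ioi hs)), integral_Ioc_eq_integral_Ioo]
  congr 1
  · rw [setIntegral_congr_fun (g := fun _ => (1 : ℝ)) measurableSet_Ioo]
    · simp [hs]
    · intro t ht
      simp only
      rw [farKernel, if_neg, sub_zero]
      rintro (h | ⟨-, h⟩)
      · exact lt_asymm h ht.2
      · exact h.not_gt ht.2
  · refine setIntegral_congr_fun measurableSet_Ioi fun t ht => ?_
    simp only [farKernel, if_pos (Or.inl ht : s < t ∨ (e ∧ s = t))]

theorem kernelExponent_farKernel_sirKernel (e : Prop) {θ a c s : ℝ} (hθ : 0 < θ) (ha : 1 < a)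
    (hc : 0 < c) (hs : 0 ≤ s) :
    kernelExponent (farKernel e (sirKernel θ a c)) s = s + (s + c) * profileTail θ a 1 := by
  rw [kernelExponent_farKernel e (isMonotoneKernel_sirKernel hθ ha hc) hs,
    setIntegral_congr_fun measurableSet_Ioi
    (fun t ht => one_sub_sirKernel hθ hc hs (hs.trans (le_of_lt ht))),
    integral_Ioi_comp_affine (by positivity), div_self (by positivity)]
  rfl

/-! ### Coverage probabilities as sums over the base stations -/

theorem one_div_pathLoss_eq_sirKernel (α θ : ℝ) {h : ℝ} (hh : 0 < h) (r q : ℝ) :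
    1 / (1 + θ * (pathLoss α h q / pathLoss α h r)) =
      sirKernel θ (α / 2) (Real.pi * h ^ 2) (Real.pi * r ^ 2) (Real.pi * q ^ 2) := by
  have h1 : (Real.pi * r ^ 2 + Real.pi * h ^ 2) / (Real.pi * q ^ 2 + Real.pi * h ^ 2) =
      (r ^ 2 + h ^ 2) / (q ^ 2 + h ^ 2) := by
    rw [← mul_add, ← mul_add, mul_div_mul_left _ _ Real.pi_ne_zero]
  have h2 : (q ^ 2 + h ^ 2) ^ (-(α / 2)) / (r ^ 2 + h ^ 2) ^ (-(α / 2)) =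
      ((r ^ 2 + h ^ 2) / (q ^ 2 + h ^ 2)) ^ (α / 2) := by
    rw [Real.rpow_neg (by positivity), Real.rpow_neg (by positivity),
      Real.div_rpow (by positivity) (by positivity), inv_div_inv]
  rw [sirKernel, h1, pathLoss, pathLoss, h2]

/-- The configurations in which all points other than `x i` are farther from the origin than
`x i`; equal distances are allowed if `e` holds. -/
def farSet (e : Prop) (i : ℕ) : Set (ℕ → Plane) :=
  {x | ∀ j, j ≠ i → ‖x i‖ < ‖x j‖ ∨ (e ∧ ‖x i‖ = ‖x j‖)}

theorem measurableSet_farSet (e : Prop) (i : ℕ) : MeasurableSet (farSet e i) := by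
  have hn : ∀ j, Measurable fun x : ℕ → Plane => ‖x j‖ := fun j => by fun_prop
  have : farSet e i = ⋂ j, {x | j ≠ i → ‖x i‖ < ‖x j‖ ∨ (e ∧ ‖x i‖ = ‖x j‖)} := by
    ext x
    simp [farSet]
  rw [this]
  refine MeasurableSet.iInter fun j => ?_
  by_cases hj : j = i
  · simp [hj]
  · have h1 : MeasurableSet {x : ℕ → Plane | ‖x i‖ < ‖x j‖} := measurableSet_lt (hn i) (hn j)
    have h2 : MeasurableSet {x : ℕ → Plane | ‖x i‖ = ‖x j‖} := measurableSet_eq_fun (hn i) (hn j)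
    by_cases he : e
    · have : {x : ℕ → Plane | j ≠ i → ‖x i‖ < ‖x j‖ ∨ (e ∧ ‖x i‖ = ‖x j‖)} =
          {x | ‖x i‖ < ‖x j‖} ∪ {x | ‖x i‖ = ‖x j‖} := by
        ext x
        simp [hj, he]
      rw [this]
      exact h1.union h2
    · have : {x : ℕ → Plane | j ≠ i → ‖x i‖ < ‖x j‖ ∨ (e ∧ ‖x i‖ = ‖x j‖)} =
          {x | ‖x i‖ < ‖x j‖} := by
        ext x
        simp [hj, he]
      rw [this]
      exact h1

/-- If some `j` violates the distance condition, its factor is 0 and the singleton `{j}` already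
makes the infimum 0. -/
theorem indicator_farSet_iInf_prod (e : Prop) (F : ℝ → ℝ → ℝ) (i : ℕ) (x : ℕ → Plane) :
    (farSet e i).indicator (fun x => ⨅ s : Finset ℕ, ∏ j ∈ s.erase i,
      ENNReal.ofReal (F (Real.pi * ‖x i‖ ^ 2) (Real.pi * ‖x j‖ ^ 2))) x =
    ⨅ s : Finset ℕ, ∏ j ∈ s.erase i,
      ENNReal.ofReal (farKernel e F (Real.pi * ‖x i‖ ^ 2) (Real.pi * ‖x j‖ ^ 2)) := by
  have hlt : ∀ j, Real.pi * ‖x i‖ ^ 2 < Real.pi * ‖x j‖ ^ 2 ↔ ‖x i‖ < ‖x j‖ := fun j => by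
    rw [mul_lt_mul_iff_right₀ Real.pi_pos, pow_lt_pow_iff_left₀ (norm_nonneg _) (norm_nonneg _)
      two_ne_zero]
  have heq : ∀ j, Real.pi * ‖x i‖ ^ 2 = Real.pi * ‖x j‖ ^ 2 ↔ ‖x i‖ = ‖x j‖ := fun j => by
    rw [mul_right_inj' Real.pi_ne_zero, pow_left_inj₀ (norm_nonneg _) (norm_nonneg _) two_ne_zero]
  by_cases hx : x ∈ farSet e i
  · rw [indicator_of_mem hx]
    refine iInf_congr fun s => Finset.prod_congr rfl fun j hj => ?_
    rw [farKernel, if_pos]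
    rw [hlt, heq]
    exact hx j (Finset.mem_erase.1 hj).1
  · rw [indicator_of_notMem hx]
    have : ∃ j, j ≠ i ∧ ¬ (‖x i‖ < ‖x j‖ ∨ (e ∧ ‖x i‖ = ‖x j‖)) := by
      by_contra h'
      exact hx fun j hj => by_contra fun h'' => h' ⟨j, hj, h''⟩
    obtain ⟨j, hj, hj'⟩ := this
    refine le_antisymm zero_le ((iInf_le _ {j}).trans (le_of_eq ?_))
    rw [Finset.erase_eq_of_notMem (by simpa using Ne.symm hj), Finset.prod_singleton, farKernel,
      if_neg, ENNReal.ofReal_zero]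
    rwa [hlt, heq]

section Network

variable {Ω : Type*} {α h θ : ℝ} {X : ℕ → Ω → Plane} {g : ℕ → Ω → ℝ}

theorem rxPower_le_interference {i j : ℕ} (hij : j ≠ i) (ω : Ω) :
    rxPower α h X g j ω ≤ interference α h X g i ω :=
  ENNReal.le_tsum (f := fun k : {k : ℕ // k ≠ i} => rxPower α h X g k ω) ⟨j, hij⟩

theorem interference_lt_rxPower (hθ : 1 ≤ θ) {i : ℕ} {ω : Ω}
    (hi : ENNReal.ofReal θ < sir α h X g i ω) :
    interference α h X g i ω < rxPower α h X g i ω := by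
  have h1 : 1 ≤ ENNReal.ofReal θ := ENNReal.one_le_ofReal.2 hθ
  have h2 := h1.trans_lt hi
  rw [sir, ENNReal.lt_div_iff_mul_lt (Or.inr ENNReal.one_ne_top) (Or.inr one_ne_zero),
    one_mul] at h2
  exact h2

/-- For `θ ≥ 1` a covering station is stronger than all the others together, hence than any other
single one; this cannot hold in both directions. -/
theorem eq_of_lt_sir (hθ : 1 ≤ θ) {i j : ℕ} {ω : Ω} (hi : ENNReal.ofReal θ < sir α h X g i ω)
    (hj : ENNReal.ofReal θ < sir α h X g j ω) : i = j := by
  by_contra hij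
  exact lt_asymm ((rxPower_le_interference (Ne.symm hij) ω).trans_lt (interference_lt_rxPower hθ hi))
    ((rxPower_le_interference hij ω).trans_lt (interference_lt_rxPower hθ hj))

variable [MeasurableSpace Ω] {P : Measure Ω} {lam : ℝ}

theorem IsRayleighNetwork.tsum_measure_lt_sir (hN : IsRayleighNetwork P lam X g) (hh : 0 < h)
    (hθ : 0 < θ) :
    ∑' i, P {ω | ENNReal.ofReal θ < sir α h X g i ω} =
      ∫⁻ ω, palmSum (sirKernel θ (α / 2) (Real.pi * h ^ 2)) (fun i => X i ω) ∂P := by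
  have hX := hN.poisson.measurable
  unfold palmSum
  rw [lintegral_tsum]
  · refine tsum_congr fun i => ?_
    have := hN.measure_lt_sir (α := α) hh hθ i MeasurableSet.univ
    simp only [mem_univ, true_and, indicator_univ] at this
    rw [this]
    simp only [one_div_pathLoss_eq_sirKernel α θ hh]
  · intro i
    refine (measurable_iInf_prod_erase (fun j => ?_) i).aemeasurable
    have := hX i
    have := hX j
    unfold sirKernel
    fun_prop

theorem IsRayleighNetwork.tsum_measure_farSet (hN : IsRayleighNetwork P lam X g) (hh : 0 < h)
    (hθ : 0 < θ) (e : Prop) :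
    ∑' i, P {ω | (fun j => X j ω) ∈ farSet e i ∧ ENNReal.ofReal θ < sir α h X g i ω} =
      ∫⁻ ω, palmSum (farKernel e (sirKernel θ (α / 2) (Real.pi * h ^ 2))) (fun i => X i ω) ∂P := by
  have hX := hN.poisson.measurable
  have hXm : Measurable fun ω j => X j ω := measurable_pi_iff.2 hX
  unfold palmSum
  have key := fun i ω => (indicator_farSet_iInf_prod e (sirKernel θ (α / 2) (Real.pi * h ^ 2)) i
    (fun j => X j ω)).symm
  simp only [key]
  rw [lintegral_tsum]
  · refine tsum_congr fun i => ?_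
    rw [hN.measure_lt_sir (α := α) hh hθ i (measurableSet_farSet e i)]
    simp only [one_div_pathLoss_eq_sirKernel α θ hh]
  · intro i
    refine (Measurable.comp (g := (farSet e i).indicator _) ?_ hXm).aemeasurable
    refine Measurable.indicator (measurable_iInf_prod_erase (fun j => ?_) i)
      (measurableSet_farSet e i)
    unfold sirKernel
    fun_prop

/-- Ties are admitted here for an upper bound; `IsRayleighNetwork.le_measure_closest` excludes them,
making the events disjoint. The two sums turn out equal. -/
theorem measure_closest_le :
    P {ω | ∃ i, (∀ j, ‖X i ω‖ ≤ ‖X j ω‖) ∧ ENNReal.ofReal θ < sir α h X g i ω} ≤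
      ∑' i, P {ω | (fun j => X j ω) ∈ farSet True i ∧ ENNReal.ofReal θ < sir α h X g i ω} := by
  refine (measure_mono ?_).trans (measure_iUnion_le _)
  rintro ω ⟨i, hi, hs⟩
  refine mem_iUnion.2 ⟨i, fun j _ => ?_, hs⟩
  exact (hi j).lt_or_eq.imp id fun h => ⟨trivial, h⟩

theorem IsRayleighNetwork.le_measure_closest (hN : IsRayleighNetwork P lam X g) :
    ∑' i, P {ω | (fun j => X j ω) ∈ farSet False i ∧ ENNReal.ofReal θ < sir α h X g i ω} ≤
      P {ω | ∃ i, (∀ j, ‖X i ω‖ ≤ ‖X j ω‖) ∧ ENNReal.ofReal θ < sir α h X g i ω} := by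
  have hX := hN.poisson.measurable
  have hXm : Measurable fun ω j => X j ω := measurable_pi_iff.2 hX
  rw [← measure_iUnion]
  · refine measure_mono fun ω hω => ?_
    obtain ⟨i, hi, hs⟩ := mem_iUnion.1 hω
    refine ⟨i, fun j => ?_, hs⟩
    by_cases hj : j = i
    · rw [hj]
    · rcases hi j hj with h | h
      exacts [h.le, h.1.elim]
  · intro i j hij
    refine Set.disjoint_left.2 fun ω hi hj => ?_
    rcases hi.1 j hij.symm with h1 | h1
    · rcases hj.1 i hij with h2 | h2
      exacts [lt_asymm h1 h2, h2.1]
    · exact h1.1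
  · exact fun i => (hXm (measurableSet_farSet False i)).inter
      (measurableSet_lt measurable_const (measurable_sir hX hN.fading_measurable α h i))

theorem measure_strongest_le :
    P {ω | ∃ i, (∀ j, sir α h X g j ω ≤ sir α h X g i ω) ∧
      ENNReal.ofReal θ < sir α h X g i ω} ≤
      ∑' i, P {ω | ENNReal.ofReal θ < sir α h X g i ω} := by
  refine (measure_mono ?_).trans (measure_iUnion_le _)
  rintro ω ⟨i, -, hs⟩
  exact mem_iUnion.2 ⟨i, hs⟩

theorem IsRayleighNetwork.measure_strongest (hN : IsRayleighNetwork P lam X g) (hθ : 1 ≤ θ) :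
    P {ω | ∃ i, (∀ j, sir α h X g j ω ≤ sir α h X g i ω) ∧
      ENNReal.ofReal θ < sir α h X g i ω} =
      ∑' i, P {ω | ENNReal.ofReal θ < sir α h X g i ω} := by
  refine le_antisymm measure_strongest_le ?_
  rw [← measure_iUnion]
  · refine measure_mono fun ω hω => ?_
    obtain ⟨i, hs⟩ := mem_iUnion.1 hω
    refine ⟨i, fun j => ?_, hs⟩
    by_contra hji
    -- A station with larger SIR would also exceed `θ`, hence be `i` itself.
    have hij := eq_of_lt_sir hθ hs (lt_trans hs (not_le.1 hji))
    rw [hij] at hji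
    exact hji le_rfl
  · exact fun i j hij => Set.disjoint_left.2 fun ω hi hj => hij (eq_of_lt_sir hθ hi hj)
  · exact fun i => measurableSet_lt measurable_const
      (measurable_sir hN.poisson.measurable hN.fading_measurable α h i)

end Network

/-! ### The coverage formula for closest association -/

theorem integral_exp_neg_mul_Ioi_zero {r : ℝ} (hr : 0 < r) :
    ∫ s in Ioi (0 : ℝ), Real.exp (-r * s) = 1 / r := by
  rw [integral_exp_mul_Ioi (neg_lt_zero.2 hr), mul_zero, Real.exp_zero, neg_div_neg_eq]

theorem covFormulaClosest_eq {α h θ lam : ℝ} (hα : 2 < α) (hθ : 0 < θ) :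
    covFormulaClosest α h θ lam = 1 / (1 + profileTail θ (α / 2) 1) *
      Real.exp (-(lam * (Real.pi * h ^ 2 * profileTail θ (α / 2) 1))) := by
  rw [covFormulaClosest, covNlosClosest, eta_eq_profileTail hα hθ, add_sub_cancel_left]
  congr 3
  ring

/-- The exponent is affine in `s` with slope `1 + profileTail θ (α / 2) 1`, so an elementary
exponential integral remains. -/
theorem mul_lintegral_farKernel {α h θ lam : ℝ} (hα : 2 < α) (hh : 0 < h) (hθ : 0 < θ)
    (hlam : 0 < lam) (e : Prop) :
    ENNReal.ofReal lam * ∫⁻ s in Ioi 0, ENNReal.ofReal (Real.exp (-(lam *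
      kernelExponent (farKernel e (sirKernel θ (α / 2) (Real.pi * h ^ 2))) s))) =
      ENNReal.ofReal (covFormulaClosest α h θ lam) := by
  have ha : 1 < α / 2 := by linarith
  have hJ := profileTail_pos hθ ha zero_le_one
  set J := profileTail θ (α / 2) 1 with hJdef
  have hc : 0 < Real.pi * h ^ 2 := by positivity
  have hr : 0 < lam * (1 + J) := by positivity
  have h1 : ∀ s ∈ Ioi (0 : ℝ), ENNReal.ofReal (Real.exp (-(lam *
      kernelExponent (farKernel e (sirKernel θ (α / 2) (Real.pi * h ^ 2))) s))) =
      ENNReal.ofReal (Real.exp (-(lam * (Real.pi * h ^ 2 * J)))) *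
        ENNReal.ofReal (Real.exp (-(lam * (1 + J)) * s)) := by
    intro s hs
    rw [kernelExponent_farKernel_sirKernel e hθ ha hc (le_of_lt hs),
      ← ENNReal.ofReal_mul (Real.exp_pos _).le, ← Real.exp_add]
    congr 2
    ring
  rw [setLIntegral_congr_fun measurableSet_Ioi h1, lintegral_const_mul _ (by fun_prop),
    ← ofReal_integral_eq_lintegral_ofReal (integrableOn_exp_mul_Ioi (neg_lt_zero.2 hr) 0)
      (ae_of_all _ fun s => (Real.exp_pos _).le), integral_exp_neg_mul_Ioi_zero hr,
    ← ENNReal.ofReal_mul (Real.exp_pos _).le, ← ENNReal.ofReal_mul hlam.le,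
    covFormulaClosest_eq hα hθ, ← hJdef]
  congr 1
  field_simp

/-! ### The coverage formula for strongest association -/

/-- Scaling `v` by `ρ`. With `ρ = (r / h) ^ 2` it moves the `r`-dependence of `η(θ r ^ α, 1, h)`
into the lower limit of the tail. -/
theorem profileTail_mul_rpow {θ a ρ : ℝ} (hρ : 0 < ρ) :
    profileTail (θ * ρ ^ a) a 1 = ρ * profileTail θ a (1 / ρ) := by
  have h := integral_Ioi_comp_affine hρ 1 0 (profile θ a)
  rw [add_zero] at h
  rw [profileTail, profileTail, ← h]
  refine setIntegral_congr_fun measurableSet_Ioi fun v hv => ?_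
  have hv0 : (0 : ℝ) ≤ v := zero_le_one.trans (le_of_lt hv)
  have hp : 0 < ρ ^ a := Real.rpow_pos_of_pos hρ a
  simp only [profile, add_zero]
  rw [Real.div_rpow hv0 hρ.le, show v ^ a / ρ ^ a + θ = (v ^ a + θ * ρ ^ a) / ρ ^ a by field_simp,
    inv_div]
  ring

theorem covIntegrandStrongest_eq {α h θ lam r : ℝ} (hα : 2 < α) (hh : 0 < h) (hθ : 0 < θ)
    (hr : h < r) :
    covIntegrandStrongest α h θ lam r = Real.exp (-(lam *
      kernelExponent (sirKernel θ (α / 2) (Real.pi * h ^ 2)) (Real.pi * r ^ 2 - Real.pi * h ^ 2)))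
      * r := by
  have hr0 : 0 < r := hh.trans hr
  have hs : 0 ≤ Real.pi * r ^ 2 - Real.pi * h ^ 2 := by
    have : h ^ 2 ≤ r ^ 2 := by gcongr
    nlinarith [Real.pi_pos]
  have hρ : 0 < (r / h) ^ 2 := by positivity
  have hY : θ * r ^ α / h ^ α = θ * ((r / h) ^ 2) ^ (α / 2) := by
    rw [← Real.rpow_natCast, ← Real.rpow_mul (by positivity), Real.div_rpow hr0.le hh.le]
    push_cast
    rw [mul_div_cancel₀ _ (two_ne_zero), mul_div_assoc]
  have heta : eta α (θ * r ^ α) 1 h - 1 = (r / h) ^ 2 * profileTail θ (α / 2) (1 / (r / h) ^ 2) := by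
    rw [eta_one_eq hα (by positivity), hY, ← profileTail_mul_rpow hρ, add_sub_cancel_left]
    rfl
  rw [covIntegrandStrongest, heta, kernelExponent_sirKernel hθ (by positivity) hs, sub_add_cancel,
    show Real.pi * h ^ 2 / (Real.pi * r ^ 2) = 1 / (r / h) ^ 2 by field_simp]
  congr 3
  field_simp

section Strongest

variable {θ a c lam : ℝ}

theorem mul_profileTail_one_le (hθ : 0 < θ) (ha : 1 < a) (hc : 0 < c) {s : ℝ} (hs : 0 ≤ s) :
    (s + c) * profileTail θ a 1 ≤ kernelExponent (sirKernel θ a c) s := by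
  rw [kernelExponent_sirKernel hθ hc hs]
  refine mul_le_mul_of_nonneg_left (profileTail_anti hθ ha (by positivity) ?_) (by positivity)
  rw [div_le_one (by positivity)]
  linarith

theorem kernelExponent_le_mul (hθ : 0 < θ) (ha : 1 < a) (hc : 0 < c) {s : ℝ} (hs : 0 ≤ s) :
    kernelExponent (sirKernel θ a c) s ≤ (s + c) * profileTail θ a 0 := by
  rw [kernelExponent_sirKernel hθ hc hs]
  exact mul_le_mul_of_nonneg_left (profileTail_anti hθ ha le_rfl (by positivity)) (by positivity)

/-- Since `(s + c) * (c / (s + c)) = c`, the loss is bounded uniformly in `s`; it costs only a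
factor `exp (lam * c)`, which tends to 1 at low density. -/
theorem mul_profileTail_zero_sub_le (hθ : 0 < θ) (ha : 1 < a) (hc : 0 < c) {s : ℝ} (hs : 0 ≤ s) :
    (s + c) * profileTail θ a 0 - c ≤ kernelExponent (sirKernel θ a c) s := by
  have h1 := mul_le_mul_of_nonneg_left
    (profileTail_zero_sub_le hθ ha (show 0 ≤ c / (s + c) by positivity))
    (show 0 ≤ s + c by positivity)
  rw [kernelExponent_sirKernel hθ hc hs]
  refine le_trans (le_of_eq ?_) h1
  field_simp

theorem integrableOn_exp_neg_add_mul {κ : ℝ} (hlam : 0 < lam) (hκ : 0 < κ) :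
    IntegrableOn (fun s => Real.exp (-(lam * ((s + c) * κ)))) (Ioi 0) := by
  have h := (integrableOn_exp_mul_Ioi (neg_lt_zero.2 (mul_pos hlam hκ)) 0).const_mul
    (Real.exp (-(lam * (c * κ))))
  refine IntegrableOn.congr_fun h (fun s _ => ?_) measurableSet_Ioi
  rw [← Real.exp_add]
  congr 1
  ring

theorem mul_integral_exp_neg_add_mul {κ : ℝ} (hlam : 0 < lam) (hκ : 0 < κ) :
    lam * ∫ s in Ioi (0 : ℝ), Real.exp (-(lam * ((s + c) * κ))) =
      Real.exp (-(lam * (c * κ))) / κ := by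
  have h : ∀ s : ℝ, Real.exp (-(lam * ((s + c) * κ))) =
      Real.exp (-(lam * (c * κ))) * Real.exp (-(lam * κ) * s) := fun s => by
    rw [← Real.exp_add]
    congr 1
    ring
  simp only [h]
  rw [integral_const_mul, integral_exp_neg_mul_Ioi_zero (mul_pos hlam hκ)]
  field_simp

theorem integrableOn_exp_neg_kernelExponent (hθ : 0 < θ) (ha : 1 < a) (hc : 0 < c)
    (hlam : 0 < lam) :
    IntegrableOn (fun s => Real.exp (-(lam * kernelExponent (sirKernel θ a c) s))) (Ioi 0) := by
  refine (integrableOn_exp_neg_add_mul (c := c) hlam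
    (profileTail_pos hθ ha zero_le_one)).mono' ?_ ?_
  · refine (aemeasurable_restrict_of_antitoneOn measurableSet_Ioi ?_).aestronglyMeasurable
    intro s hs s' _ h
    refine Real.exp_le_exp.2 (neg_le_neg (mul_le_mul_of_nonneg_left ?_ hlam.le))
    exact (isMonotoneKernel_sirKernel hθ ha hc).kernelExponent_mono (le_of_lt hs) h
  · refine (ae_restrict_iff' measurableSet_Ioi).2 (ae_of_all _ fun s hs => ?_)
    rw [Real.norm_of_nonneg (Real.exp_pos _).le]
    exact Real.exp_le_exp.2 (neg_le_neg (mul_le_mul_of_nonneg_left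
      (mul_profileTail_one_le hθ ha hc (le_of_lt hs)) hlam.le))

/-- The coverage expression for strongest association as an integral over the squared distance. -/
noncomputable def strongestIntegral (θ a c lam : ℝ) : ℝ :=
  lam * ∫ s in Ioi (0 : ℝ), Real.exp (-(lam * kernelExponent (sirKernel θ a c) s))

theorem strongestIntegral_le_exp_profileTail_one (hθ : 0 < θ) (ha : 1 < a) (hc : 0 < c) (hlam : 0 < lam) :
    strongestIntegral θ a c lam ≤
      Real.exp (-(lam * (c * profileTail θ a 1))) / profileTail θ a 1 := by
  rw [← mul_integral_exp_neg_add_mul hlam (profileTail_pos hθ ha zero_le_one)]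
  refine mul_le_mul_of_nonneg_left (setIntegral_mono_on
    (integrableOn_exp_neg_kernelExponent hθ ha hc hlam)
    (integrableOn_exp_neg_add_mul hlam (profileTail_pos hθ ha zero_le_one)) measurableSet_Ioi
    fun s hs => ?_) hlam.le
  exact Real.exp_le_exp.2 (neg_le_neg (mul_le_mul_of_nonneg_left
    (mul_profileTail_one_le hθ ha hc (le_of_lt hs)) hlam.le))

theorem exp_profileTail_zero_le_strongestIntegral (hθ : 0 < θ) (ha : 1 < a) (hc : 0 < c) (hlam : 0 < lam) :
    Real.exp (-(lam * (c * profileTail θ a 0))) / profileTail θ a 0 ≤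
      strongestIntegral θ a c lam := by
  rw [← mul_integral_exp_neg_add_mul hlam (profileTail_pos hθ ha le_rfl)]
  refine mul_le_mul_of_nonneg_left (setIntegral_mono_on
    (integrableOn_exp_neg_add_mul hlam (profileTail_pos hθ ha le_rfl))
    (integrableOn_exp_neg_kernelExponent hθ ha hc hlam) measurableSet_Ioi
    fun s hs => ?_) hlam.le
  exact Real.exp_le_exp.2 (neg_le_neg (mul_le_mul_of_nonneg_left
    (kernelExponent_le_mul hθ ha hc (le_of_lt hs)) hlam.le))

theorem strongestIntegral_le_exp_profileTail_zero (hθ : 0 < θ) (ha : 1 < a) (hc : 0 < c) (hlam : 0 < lam) :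
    strongestIntegral θ a c lam ≤ Real.exp (lam * c) *
      (Real.exp (-(lam * (c * profileTail θ a 0))) / profileTail θ a 0) := by
  have hK := profileTail_pos hθ ha le_rfl
  rw [← mul_integral_exp_neg_add_mul hlam hK, mul_left_comm, ← integral_const_mul]
  refine mul_le_mul_of_nonneg_left (setIntegral_mono_on
    (integrableOn_exp_neg_kernelExponent hθ ha hc hlam)
    ((integrableOn_exp_neg_add_mul hlam hK).const_mul _) measurableSet_Ioi
    fun s hs => ?_) hlam.le
  rw [← Real.exp_add]
  have := mul_le_mul_of_nonneg_left (mul_profileTail_zero_sub_le hθ ha hc (le_of_lt hs)) hlam.le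
  exact Real.exp_le_exp.2 (by linarith)

theorem strongestIntegral_nonneg (hlam : 0 ≤ lam) : 0 ≤ strongestIntegral θ a c lam :=
  mul_nonneg hlam (integral_nonneg fun _ => (Real.exp_pos _).le)

theorem mul_lintegral_sirKernel (hθ : 0 < θ) (ha : 1 < a) (hc : 0 < c) (hlam : 0 < lam) :
    ENNReal.ofReal lam * ∫⁻ s in Ioi 0, ENNReal.ofReal (Real.exp (-(lam *
      kernelExponent (sirKernel θ a c) s))) = ENNReal.ofReal (strongestIntegral θ a c lam) := by
  rw [strongestIntegral, ENNReal.ofReal_mul hlam.le, ofReal_integral_eq_lintegral_ofReal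
    (integrableOn_exp_neg_kernelExponent hθ ha hc hlam) (ae_of_all _ fun _ => (Real.exp_pos _).le)]

theorem tendsto_strongestIntegral_zero (hθ : 0 < θ) (ha : 1 < a) (hc : 0 < c) :
    Tendsto (fun lam => strongestIntegral θ a c lam) (𝓝[>] 0) (𝓝 (1 / profileTail θ a 0)) := by
  have hl : Tendsto (fun lam => Real.exp (-(lam * (c * profileTail θ a 0))) / profileTail θ a 0)
      (𝓝[>] 0) (𝓝 (1 / profileTail θ a 0)) := by
    have hcont : Continuous fun lam : ℝ =>
        Real.exp (-(lam * (c * profileTail θ a 0))) / profileTail θ a 0 := by fun_prop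
    have := (hcont.tendsto 0).mono_left (nhdsWithin_le_nhds (s := Ioi 0))
    simpa using this
  have he : Tendsto (fun lam : ℝ => Real.exp (lam * c)) (𝓝[>] 0) (𝓝 1) := by
    have hcont : Continuous fun lam : ℝ => Real.exp (lam * c) := by fun_prop
    have := (hcont.tendsto 0).mono_left (nhdsWithin_le_nhds (s := Ioi 0))
    simpa using this
  have hu := he.mul hl
  rw [one_mul] at hu
  exact tendsto_of_tendsto_of_tendsto_of_le_of_le' hl hu
    (eventually_nhdsWithin_of_forall fun lam h => exp_profileTail_zero_le_strongestIntegral hθ ha hc h)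
    (eventually_nhdsWithin_of_forall fun lam h => strongestIntegral_le_exp_profileTail_zero hθ ha hc h)

theorem tendsto_exp_neg_mul_atTop {r : ℝ} (hr : 0 < r) :
    Tendsto (fun lam : ℝ => Real.exp (-(lam * r))) atTop (𝓝 0) :=
  Real.tendsto_exp_neg_atTop_nhds_zero.comp (tendsto_id.atTop_mul_const hr)

theorem tendsto_strongestIntegral_atTop (hθ : 0 < θ) (ha : 1 < a) (hc : 0 < c) :
    Tendsto (fun lam => strongestIntegral θ a c lam) atTop (𝓝 0) := by
  have hJ := profileTail_pos hθ ha zero_le_one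
  have hu := (tendsto_exp_neg_mul_atTop (mul_pos hc hJ)).div_const (profileTail θ a 1)
  rw [zero_div] at hu
  refine tendsto_of_tendsto_of_tendsto_of_le_of_le' tendsto_const_nhds hu ?_ ?_
  · filter_upwards [eventually_ge_atTop 0] with lam h using strongestIntegral_nonneg h
  · filter_upwards [eventually_gt_atTop 0] with lam h using strongestIntegral_le_exp_profileTail_one hθ ha hc h

/-- Euler's integral for the reflection formula. -/
theorem profileTail_zero_eq (hθ : 0 < θ) (ha : 1 < a) :
    profileTail θ a 0 = Real.Gamma (1 + 1 / a) * Real.Gamma (1 - 1 / a) * θ ^ (1 / a) := by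
  have ha0 : 0 < a := by linarith
  have hb1 : 1 / a < 1 := (div_lt_one ha0).2 ha
  -- Write `1 / (v ^ a + θ)` as the integral of `exp (-(v ^ a + θ) x)` over `x > 0` and integrate in
  -- `v` first. Both integrals are then Gamma integrals, and nonnegativity lets Tonelli justify the
  -- swap.
  have hinner : ∀ v ∈ Ioi (0 : ℝ), ENNReal.ofReal (profile θ a v) =
      ∫⁻ x in Ioi (0 : ℝ), ENNReal.ofReal (θ * Real.exp (-(v ^ a + θ) * x)) := by
    intro v hv
    have hp : 0 < v ^ a + θ := by have := Real.rpow_pos_of_pos hv a; positivity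
    rw [← ofReal_integral_eq_lintegral_ofReal
      ((integrableOn_exp_mul_Ioi (neg_lt_zero.2 hp) 0).const_mul θ)
      (ae_of_all _ fun x => mul_nonneg hθ.le (Real.exp_pos _).le), integral_const_mul,
      integral_exp_neg_mul_Ioi_zero hp, one_div]
    rfl
  have houter : ∀ x ∈ Ioi (0 : ℝ),
      ∫⁻ v in Ioi (0 : ℝ), ENNReal.ofReal (θ * Real.exp (-(v ^ a + θ) * x)) =
      ENNReal.ofReal (Real.Gamma (1 + 1 / a) * θ * (x ^ ((1 - 1 / a) - 1) * Real.exp (-(θ * x)))) := by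
    intro x hx
    have hx0 : 0 < x := hx
    have hsplit : ∀ v : ℝ, θ * Real.exp (-(v ^ a + θ) * x) =
        (θ * Real.exp (-(θ * x))) * Real.exp (-x * v ^ a) := fun v => by
      rw [mul_assoc, ← Real.exp_add]
      congr 2
      ring
    have hint := integral_exp_neg_mul_rpow ha0 hx0
    have hI : IntegrableOn (fun v : ℝ => Real.exp (-x * v ^ a)) (Ioi 0) := by
      -- A non-integrable function has integral 0 by convention, contradicting the known positive
      -- value.
      by_contra hni
      rw [integral_undef hni] at hint
      have h1 : 0 < x ^ (-1 / a) * Real.Gamma (1 / a + 1) :=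
        mul_pos (Real.rpow_pos_of_pos hx0 _) (Real.Gamma_pos_of_pos (by positivity))
      exact h1.ne hint
    simp only [hsplit]
    rw [← ofReal_integral_eq_lintegral_ofReal (hI.const_mul _)
      (ae_of_all _ fun v => by positivity), integral_const_mul, hint]
    congr 1
    rw [add_comm (1 / a) 1, show (1 - 1 / a - 1 : ℝ) = -1 / a by ring]
    ring
  have hfin : IntegrableOn (fun x : ℝ => x ^ ((1 - 1 / a) - 1) * Real.exp (-(θ * x))) (Ioi 0) := by
    by_contra hni
    have h := Real.integral_rpow_mul_exp_neg_mul_Ioi (show 0 < 1 - 1 / a by linarith) hθ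
    rw [integral_undef hni] at h
    have h1 : 0 < (1 / θ) ^ (1 - 1 / a) * Real.Gamma (1 - 1 / a) :=
      mul_pos (Real.rpow_pos_of_pos (by positivity) _) (Real.Gamma_pos_of_pos (by linarith))
    exact h1.ne h
  have hE : ENNReal.ofReal (profileTail θ a 0) = ENNReal.ofReal
      (Real.Gamma (1 + 1 / a) * θ * ((1 / θ) ^ (1 - 1 / a) * Real.Gamma (1 - 1 / a))) := by
    have hG : 0 < Real.Gamma (1 + 1 / a) := Real.Gamma_pos_of_pos (by positivity)
    rw [profileTail, ofReal_integral_eq_lintegral_ofReal (integrableOn_profile hθ ha le_rfl)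
      ((ae_restrict_iff' measurableSet_Ioi).2 (ae_of_all _ fun v hv =>
        profile_nonneg hθ (le_of_lt hv))), setLIntegral_congr_fun measurableSet_Ioi hinner,
      lintegral_lintegral_swap, setLIntegral_congr_fun measurableSet_Ioi houter,
      ← ofReal_integral_eq_lintegral_ofReal (hfin.const_mul _), integral_const_mul,
      Real.integral_rpow_mul_exp_neg_mul_Ioi (show 0 < 1 - 1 / a by linarith) hθ]
    · refine (ae_restrict_iff' measurableSet_Ioi).2 (ae_of_all _ fun x hx => ?_)
      have := Real.rpow_nonneg (le_of_lt hx) (1 - 1 / a - 1)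
      simp only [Pi.zero_apply]
      positivity
    · refine Measurable.aemeasurable ?_
      unfold Function.uncurry
      fun_prop
  rw [ENNReal.ofReal_eq_ofReal_iff (profileTail_pos hθ ha le_rfl).le] at hE
  · rw [hE, one_div θ, Real.inv_rpow hθ.le, ← Real.rpow_neg hθ.le]
    have : θ * θ ^ (-(1 - 1 / a)) = θ ^ (1 / a) := by
      rw [← Real.rpow_one_add' hθ.le]
      · congr 1
        ring
      · have : 0 < 1 / a := by positivity
        intro h0
        linarith
    rw [← this]
    ring
  · have h1 : 0 < Real.Gamma (1 - 1 / a) := Real.Gamma_pos_of_pos (by linarith)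
    have hG : 0 < Real.Gamma (1 + 1 / a) := Real.Gamma_pos_of_pos (by positivity)
    positivity

end Strongest

/-- `Γ(1 - b) = -b Γ(-b)` with `b = 2 / α` identifies `2 ζ(1)` with `Γ(1 + b) Γ(1 - b)`. -/
theorem covNlosStrongest_eq {α θ : ℝ} (hα : 2 < α) (hθ : 0 < θ) :
    covNlosStrongest α θ = 1 / profileTail θ (α / 2) 0 := by
  have hb : (2 : ℝ) / α = 1 / (α / 2) := by rw [one_div_div]
  have hα0 : 0 < α := by linarith
  have hb0 : -(2 / α) ≠ 0 := by
    have : 0 < 2 / α := by positivity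
    linarith
  have hG := Real.Gamma_add_one hb0
  rw [covNlosStrongest, profileTail_zero_eq hθ (by linarith), ← hb, zetaFading, Real.Gamma_one,
    sub_eq_neg_add, hG]
  congr 2
  field_simp

/-- In the coverage integral `r` is the distance to the elevated station, so `s = π r² - π h²` is
`π` times the squared horizontal distance. -/
theorem image_sq_Ioi {h : ℝ} (hh : 0 < h) :
    (fun r => Real.pi * r ^ 2 - Real.pi * h ^ 2) '' Ioi h = Ioi 0 := by
  ext s
  constructor
  · rintro ⟨r, hr, rfl⟩
    have h1 : h ^ 2 < r ^ 2 := by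
      have : h < r := hr
      gcongr
    have := mul_lt_mul_of_pos_left h1 Real.pi_pos
    exact mem_Ioi.2 (by linarith)
  · intro hs
    have hs0 : 0 < s := hs
    refine ⟨√(h ^ 2 + s / Real.pi), ?_, ?_⟩
    · refine mem_Ioi.2 (Real.lt_sqrt_of_sq_lt ?_)
      have : 0 < s / Real.pi := div_pos hs0 Real.pi_pos
      linarith
    · simp only
      rw [Real.sq_sqrt (by positivity)]
      field_simp
      ring

section CoverageFormula

variable {α h θ lam : ℝ}

theorem hasDerivWithinAt_sq (h r : ℝ) (s : Set ℝ) :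
    HasDerivWithinAt (fun r => Real.pi * r ^ 2 - Real.pi * h ^ 2) (2 * Real.pi * r) s r := by
  have h1 := (((hasDerivAt_pow 2 r).const_mul Real.pi).sub_const (Real.pi * h ^ 2)).hasDerivWithinAt
    (s := s)
  have h2 : Real.pi * (((2 : ℕ) : ℝ) * r ^ (2 - 1)) = 2 * Real.pi * r := by
    norm_num
    ring
  rwa [h2] at h1

theorem injOn_sq (hh : 0 < h) :
    InjOn (fun r => Real.pi * r ^ 2 - Real.pi * h ^ 2) (Ioi h) := by
  intro x hx y hy hxy
  have h1 : Real.pi * x ^ 2 = Real.pi * y ^ 2 := by simpa using hxy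
  have h2 := mul_left_cancel₀ Real.pi_ne_zero h1
  exact (pow_left_inj₀ (hh.trans hx).le (hh.trans hy).le two_ne_zero).1 h2

theorem abs_deriv_smul_eq (hα : 2 < α) (hh : 0 < h) (hθ : 0 < θ) {r : ℝ} (hr : r ∈ Ioi h) :
    |2 * Real.pi * r| • Real.exp (-(lam * kernelExponent (sirKernel θ (α / 2) (Real.pi * h ^ 2))
      (Real.pi * r ^ 2 - Real.pi * h ^ 2))) =
      2 * Real.pi * covIntegrandStrongest α h θ lam r := by
  have hr0 : 0 < r := hh.trans hr
  rw [covIntegrandStrongest_eq hα hh hθ hr, abs_of_pos (by positivity), smul_eq_mul]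
  ring

theorem integrableOn_covIntegrandStrongest (hα : 2 < α) (hh : 0 < h) (hθ : 0 < θ)
    (hlam : 0 < lam) : IntegrableOn (covIntegrandStrongest α h θ lam) (Ioi h) := by
  have h1 := integrableOn_exp_neg_kernelExponent hθ (show 1 < α / 2 by linarith)
    (show 0 < Real.pi * h ^ 2 by positivity) hlam
  rw [← image_sq_Ioi hh, integrableOn_image_iff_integrableOn_abs_deriv_smul measurableSet_Ioi
    (fun r _ => hasDerivWithinAt_sq h r _) (injOn_sq hh)] at h1
  refine IntegrableOn.congr_fun (h1.const_mul (1 / (2 * Real.pi))) (fun r hr => ?_)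
    measurableSet_Ioi
  rw [abs_deriv_smul_eq hα hh hθ hr]
  field_simp

theorem covFormulaStrongest_eq (hα : 2 < α) (hh : 0 < h) (hθ : 0 < θ) :
    covFormulaStrongest α h θ lam = strongestIntegral θ (α / 2) (Real.pi * h ^ 2) lam := by
  rw [strongestIntegral, ← image_sq_Ioi hh, integral_image_eq_integral_abs_deriv_smul
    measurableSet_Ioi (fun r _ => hasDerivWithinAt_sq h r _) (injOn_sq hh),
    setIntegral_congr_fun measurableSet_Ioi fun r hr => abs_deriv_smul_eq hα hh hθ hr,
    integral_const_mul, covFormulaStrongest]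
  ring

/-! ### Limits of the two coverage expressions -/

theorem tendsto_covFormulaClosest_zero (hα : 2 < α) (hθ : 0 < θ) :
    Tendsto (fun lam => covFormulaClosest α h θ lam) (𝓝[>] 0) (𝓝 (covNlosClosest α θ)) := by
  have hcont : Continuous fun lam => covFormulaClosest α h θ lam := by
    simp only [covFormulaClosest_eq hα hθ]
    fun_prop
  have := (hcont.tendsto 0).mono_left (nhdsWithin_le_nhds (s := Ioi 0))
  simpa [covFormulaClosest] using this

theorem tendsto_covFormulaClosest_atTop (hα : 2 < α) (hh : 0 < h) (hθ : 0 < θ) :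
    Tendsto (fun lam => covFormulaClosest α h θ lam) atTop (𝓝 0) := by
  have hJ := profileTail_pos hθ (show 1 < α / 2 by linarith) zero_le_one
  have := (tendsto_exp_neg_mul_atTop (show 0 < Real.pi * h ^ 2 * profileTail θ (α / 2) 1 by
    positivity)).const_mul (1 / (1 + profileTail θ (α / 2) 1))
  rw [mul_zero] at this
  simpa only [covFormulaClosest_eq hα hθ] using this

theorem tendsto_covFormulaStrongest_zero (hα : 2 < α) (hh : 0 < h) (hθ : 0 < θ) :
    Tendsto (fun lam => covFormulaStrongest α h θ lam) (𝓝[>] 0) (𝓝 (covNlosStrongest α θ)) := by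
  simp only [covFormulaStrongest_eq hα hh hθ, covNlosStrongest_eq hα hθ]
  exact tendsto_strongestIntegral_zero hθ (by linarith) (by positivity)

theorem tendsto_covFormulaStrongest_atTop (hα : 2 < α) (hh : 0 < h) (hθ : 0 < θ) :
    Tendsto (fun lam => covFormulaStrongest α h θ lam) atTop (𝓝 0) := by
  simp only [covFormulaStrongest_eq hα hh hθ]
  exact tendsto_strongestIntegral_atTop hθ (by linarith) (by positivity)

/-! ### The coverage probabilities of the Poisson network -/

variable {Ω : Type*} [MeasurableSpace Ω] {P : Measure Ω} {X : ℕ → Ω → Plane} {g : ℕ → Ω → ℝ}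

/-- The sums with and without ties have the same value and enclose the measure of the coverage
event, whose own measurability is not needed. -/
theorem IsRayleighNetwork.covProbClosest_eq (hN : IsRayleighNetwork P lam X g) (hα : 2 < α)
    (hh : 0 < h) (hθ : 0 < θ) (hlam : 0 < lam) :
    covProbClosest α h X g P θ = covFormulaClosest α h θ lam := by
  have := hN.isProbabilityMeasure
  have hK := isMonotoneKernel_sirKernel hθ (show 1 < α / 2 by linarith)
    (show 0 < Real.pi * h ^ 2 by positivity)
  have hval : ∀ e : Prop, ∑' i, P {ω | (fun j => X j ω) ∈ farSet e i ∧
      ENNReal.ofReal θ < sir α h X g i ω} = ENNReal.ofReal (covFormulaClosest α h θ lam) :=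
    fun e => by
      rw [hN.tsum_measure_farSet hh hθ e,
        lintegral_palmSum (isMonotoneKernel_farKernel e hK) hN.poisson hlam,
        mul_lintegral_farKernel hα hh hθ hlam e]
  have h1 := le_antisymm (measure_closest_le.trans_eq (hval True))
    ((hval False).symm.trans_le hN.le_measure_closest)
  rw [covProbClosest, measureReal_def, h1, ENNReal.toReal_ofReal]
  rw [covFormulaClosest_eq hα hθ]
  have := profileTail_pos hθ (show 1 < α / 2 by linarith) zero_le_one
  positivity

theorem IsRayleighNetwork.tsum_measure_lt_sir_eq (hN : IsRayleighNetwork P lam X g) (hα : 2 < α)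
    (hh : 0 < h) (hθ : 0 < θ) (hlam : 0 < lam) :
    ∑' i, P {ω | ENNReal.ofReal θ < sir α h X g i ω} =
      ENNReal.ofReal (covFormulaStrongest α h θ lam) := by
  have := hN.isProbabilityMeasure
  have ha : 1 < α / 2 := by linarith
  have hc : 0 < Real.pi * h ^ 2 := by positivity
  rw [hN.tsum_measure_lt_sir hh hθ,
    lintegral_palmSum (isMonotoneKernel_sirKernel hθ ha hc) hN.poisson hlam,
    mul_lintegral_sirKernel hθ ha hc hlam, covFormulaStrongest_eq hα hh hθ]

theorem covFormulaStrongest_nonneg (hα : 2 < α) (hh : 0 < h) (hθ : 0 < θ) (hlam : 0 < lam) :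
    0 ≤ covFormulaStrongest α h θ lam := by
  rw [covFormulaStrongest_eq hα hh hθ]
  exact strongestIntegral_nonneg hlam.le

theorem IsRayleighNetwork.covProbStrongest_le (hN : IsRayleighNetwork P lam X g) (hα : 2 < α)
    (hh : 0 < h) (hθ : 0 < θ) (hlam : 0 < lam) :
    covProbStrongest α h X g P θ ≤ covFormulaStrongest α h θ lam := by
  refine ENNReal.toReal_le_of_le_ofReal (covFormulaStrongest_nonneg hα hh hθ hlam) ?_
  rw [← hN.tsum_measure_lt_sir_eq hα hh hθ hlam]
  exact measure_strongest_le

theorem IsRayleighNetwork.covProbStrongest_eq (hN : IsRayleighNetwork P lam X g) (hα : 2 < α)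
    (hh : 0 < h) (hθ : 1 ≤ θ) (hlam : 0 < lam) :
    covProbStrongest α h X g P θ = covFormulaStrongest α h θ lam := by
  have hθ0 : 0 < θ := by linarith
  rw [covProbStrongest, measureReal_def, hN.measure_strongest hθ,
    hN.tsum_measure_lt_sir_eq hα hh hθ0 hlam,
    ENNReal.toReal_ofReal (covFormulaStrongest_nonneg hα hh hθ0 hlam)]

end CoverageFormula

theorem mainTheorem6 (α h θ : ℝ) (hα : 2 < α) (hh : 0 < h) (hθ : 0 < θ) :
    -- limits of the coverage expressions, for every threshold
    ((∀ lam : ℝ, 0 < lam → IntegrableOn (covIntegrandStrongest α h θ lam) (Ioi h)) ∧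
      Tendsto (fun lam => covFormulaClosest α h θ lam) (𝓝[>] 0) (𝓝 (covNlosClosest α θ)) ∧
      Tendsto (fun lam => covFormulaStrongest α h θ lam) (𝓝[>] 0) (𝓝 (covNlosStrongest α θ)) ∧
      Tendsto (fun lam => covFormulaClosest α h θ lam) atTop (𝓝 0) ∧
      Tendsto (fun lam => covFormulaStrongest α h θ lam) atTop (𝓝 0)) ∧
    -- limits of the probabilities of coverage in the Poisson network of density `lam`
    (∀ (Ω : ℝ → Type*) [∀ lam, MeasurableSpace (Ω lam)] (P : ∀ lam, Measure (Ω lam))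
      (X : ∀ lam, ℕ → Ω lam → Plane) (g : ∀ lam, ℕ → Ω lam → ℝ),
      (∀ lam : ℝ, 0 < lam → IsRayleighNetwork (P lam) lam (X lam) (g lam)) →
      Tendsto (fun lam => covProbClosest α h (X lam) (g lam) (P lam) θ) (𝓝[>] 0)
        (𝓝 (covNlosClosest α θ)) ∧
      (1 ≤ θ → Tendsto (fun lam => covProbStrongest α h (X lam) (g lam) (P lam) θ) (𝓝[>] 0)
        (𝓝 (covNlosStrongest α θ))) ∧
      Tendsto (fun lam => covProbClosest α h (X lam) (g lam) (P lam) θ) atTop (𝓝 0) ∧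
      Tendsto (fun lam => covProbStrongest α h (X lam) (g lam) (P lam) θ) atTop (𝓝 0)) := by

  refine ⟨⟨fun lam hlam => integrableOn_covIntegrandStrongest hα hh hθ hlam,
    tendsto_covFormulaClosest_zero hα hθ, tendsto_covFormulaStrongest_zero hα hh hθ,
    tendsto_covFormulaClosest_atTop hα hh hθ, tendsto_covFormulaStrongest_atTop hα hh hθ⟩, ?_⟩
  intro Ω _ P X g hN
  refine ⟨?_, fun hθ1 => ?_, ?_, ?_⟩
  -- The network is Poisson only for `lam > 0`, so probability and formula are identified only
  -- eventually along each filter.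
  · refine (tendsto_covFormulaClosest_zero (h := h) hα hθ).congr' ?_
    exact eventually_nhdsWithin_of_forall fun lam hlam =>
      ((hN lam hlam).covProbClosest_eq hα hh hθ hlam).symm
  · refine (tendsto_covFormulaStrongest_zero hα hh hθ).congr' ?_
    exact eventually_nhdsWithin_of_forall fun lam hlam =>
      ((hN lam hlam).covProbStrongest_eq hα hh hθ1 hlam).symm
  · refine (tendsto_covFormulaClosest_atTop hα hh hθ).congr' ?_
    filter_upwards [eventually_gt_atTop 0] with lam hlam
    exact ((hN lam hlam).covProbClosest_eq hα hh hθ hlam).symm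
  · refine tendsto_of_tendsto_of_tendsto_of_le_of_le' tendsto_const_nhds
      (tendsto_covFormulaStrongest_atTop hα hh hθ) (Eventually.of_forall fun _ =>
        measureReal_nonneg) ?_
    filter_upwards [eventually_gt_atTop 0] with lam hlam
    exact (hN lam hlam).covProbStrongest_le hα hh hθ hlam
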